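/- Theorem (Gaussian-LCHS). There is an absolute constant $C>0$ with the following property. Let $m\ge 0$ be an integer and let $\alpha,t,\epsilon>0$ with $\epsilon<\min\{1/\alpha,1\}$. Put $$R=\alpha\sqrt{t\log(1/\epsilon)},\qquad Q=R+\log\frac{\max\{\alpha,1\}}{\epsilon}.$$ Then there is a quantum circuit, depending only on $m,\alpha,t,\epsilon$, that acts on a system register of arbitrary finite dimension, on $m$ flag qubits and on $a$ further ancilla qubits, and that consists of at most $CQ$ queries to an oracle $U_{\mathcal A}$ or its inverse $U_{\mathcal A}^\dagger$ (acting on the system and the flag qubits) and at most $C(m+1)Q$ additional elementary gates on the qubits (arbitrary one-qubit unitaries, CNOT gates, Toffoli gates), with $a\le C\log(2+R)$, such that the following holds. Let $\mathcal A$ be an $\mathcal N\times\mathcal N$ Hermitian matrix with $$-\mathcal A^2=H\qquad\text{or}\qquad-\mathcal A^2=\begin{pmatrix}H&0\\0&*\end{pmatrix},$$ where $H$ is an $N\times N$ negative semi-definite Hermitian matrix, $N\le\mathcal N$, and let $U_{\mathcal A}$ be any block encoding of $\mathcal A$ with subnormalization factor $\alpha$ and $m$ flag qubits, that is, a unitary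 with $\mathcal A=\alpha\,(I\otimes\langle 0|^{\otimes m})\,U_{\mathcal A}\,(I\otimes|0\rangle^{\otimes m})$. Then the circuit with oracle $U_{\mathcal A}$ is a block encoding, with a subnormalization factor $\alpha_g\in(0,C]$ that depends only on $m,\alpha,t,\epsilon$, of an $N\times N$ matrix $\widetilde{e^{Ht}}$ with $$\bigl\|e^{Ht}-\widetilde{e^{Ht}}\bigr\|\le\epsilon$$ in spectral norm. Here $\widetilde{e^{Ht}}$ is $\alpha_g$ times the block of the circuit's unitary in which all $m+a$ qubits are in state $0$ and the system register is in the first $N$ basis states. -/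

import Mathlib

open scoped Matrix.Norms.L2Operator ComplexOrder

namespace GaussLCHS

/-- Elementary gates on qubits labelled by `W`, "Toffoli or simpler": an arbitrary one-qubit
unitary, a controlled-NOT, or a Toffoli gate. -/
inductive Gate (W : Type) : Type
  | single (w : W) (V : Matrix.unitaryGroup Bool ℂ) : Gate W
  | cnot (c x : W) (h : c ≠ x) : Gate W
  | toffoli (c d x : W) (hcd : c ≠ d) (hc : c ≠ x) (hd : d ≠ x) : Gate W

/-- The matrix of a gate in the computational basis `W → Bool`. -/
def Gate.toMatrix {W : Type} [Fintype W] [DecidableEq W] :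
    Gate W → Matrix (W → Bool) (W → Bool) ℂ
  | .single w V => Matrix.of fun p q =>
      if p = Function.update q w (p w) then (V : Matrix Bool Bool ℂ) (p w) (q w) else 0
  | .cnot c x _ => Matrix.of fun p q =>
      if p = Function.update q x (xor (q x) (q c)) then 1 else 0
  | .toffoli c d x _ _ _ => Matrix.of fun p q =>
      if p = Function.update q x (xor (q x) (q c && q d)) then 1 else 0

/-- One step of an algorithm that has the oracle `U`, which acts on a system register and on `m`
flag qubits, together with `a` further ancilla qubits. A step is a query to `U`, a query to `U†`,
or an elementary gate on the `m + a` qubits. -/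
inductive Step (m a : ℕ) : Type
  | query : Step m a
  | queryInv : Step m a
  | gate (g : Gate (Fin m ⊕ Fin a)) : Step m a

/-- A matrix on `system ⊗ (m flag qubits)`, acting as the identity on `a` further qubits. -/
def extend {ι : Type} {m : ℕ} (a : ℕ)
    (U : Matrix (ι × (Fin m → Bool)) (ι × (Fin m → Bool)) ℂ) :
    Matrix (ι × (Fin m ⊕ Fin a → Bool)) (ι × (Fin m ⊕ Fin a → Bool)) ℂ :=
  Matrix.of fun p q =>
    if p.2 ∘ Sum.inr = q.2 ∘ Sum.inr then U (p.1, p.2 ∘ Sum.inl) (q.1, q.2 ∘ Sum.inl) else 0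

/-- The matrix that a step applies to `system ⊗ (m + a qubits)`. -/
def Step.toMatrix {ι : Type} [DecidableEq ι] {m a : ℕ}
    (U : Matrix (ι × (Fin m → Bool)) (ι × (Fin m → Bool)) ℂ) :
    Step m a → Matrix (ι × (Fin m ⊕ Fin a → Bool)) (ι × (Fin m ⊕ Fin a → Bool)) ℂ
  | .query => extend a U
  | .queryInv => extend a U.conjTranspose
  | .gate g => Matrix.kronecker (1 : Matrix ι ι ℂ) g.toMatrix

/-- A query circuit is a list of steps; the head of the list is executed first. -/
abbrev Circuit (m a : ℕ) : Type := List (Step m a)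

/-- The matrix implemented by a circuit when its oracle is `U`. -/
def Circuit.eval {ι : Type} [Fintype ι] [DecidableEq ι] {m a : ℕ}
    (U : Matrix (ι × (Fin m → Bool)) (ι × (Fin m → Bool)) ℂ) :
    Circuit m a → Matrix (ι × (Fin m ⊕ Fin a → Bool)) (ι × (Fin m ⊕ Fin a → Bool)) ℂ
  | [] => 1
  | s :: c => Circuit.eval U c * s.toMatrix U

/-- The number of queries to `U` and `U†`. -/
def Circuit.queries {m a : ℕ} : Circuit m a → ℕ
  | [] => 0
  | .query :: c => Circuit.queries c + 1
  | .queryInv :: c => Circuit.queries c + 1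
  | .gate _ :: c => Circuit.queries c

/-- The number of elementary gates, not counting the inside of the oracle. -/
def Circuit.gates {m a : ℕ} : Circuit m a → ℕ
  | [] => 0
  | .query :: c => Circuit.gates c
  | .queryInv :: c => Circuit.gates c
  | .gate _ :: c => Circuit.gates c + 1

/-- `U` is a block encoding of `B` with subnormalization factor `α`: `U` is unitary and `B` is `α`
times the block of `U` in which all qubits `W` are in state `0` and the system register is in one
of the basis states `s i`. For `s` the identity this is `B = α (I ⊗ ⟨0|) U (I ⊗ |0⟩)`. -/
def IsBlockEncoding {ι κ W : Type} [Fintype ι] [DecidableEq ι] [Fintype W] [DecidableEq W]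
    (s : κ ↪ ι) (α : ℝ) (U : Matrix (ι × (W → Bool)) (ι × (W → Bool)) ℂ)
    (B : Matrix κ κ ℂ) : Prop :=
  U ∈ Matrix.unitaryGroup (ι × (W → Bool)) ℂ ∧
    B = (α : ℂ) • U.submatrix (fun i => (s i, fun _ => false)) (fun i => (s i, fun _ => false))

end GaussLCHS

namespace GaussLCHS

/-! ### Quantum signal processing on the unit circle: complementary polynomials and factorisation.
-/

section Polynomials

open Polynomial ComplexConjugate

/-! Let `R` be the reflection `1 - 2|0⟩⟨0|` on the flags, `X` the isometry adjoining flags in state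
`0`, and `W = R U† R U`. Since the encoded block `A/α` is Hermitian, `(2 + W + W⁻¹) X = 4 X (A/α)²`
(`walk_add_walkInv_mul`). Intertwining passes to exponentials, so with `τ = α² t / 2` the operator
`exp (-(τ/2)(2 + W + W⁻¹))` has flag block `exp (-t A²)`, whose upper left block is `exp (t H)`. No
eigenvectors or integral representation are needed.

Expanding `exp (-τ) exp (-(τ/2) W) exp (-(τ/2) W⁻¹)` gives a signed sum of the `W^j W^(-k)`, whose
weights are the joint law of two independent Poisson variables of mean `τ/2`. As `W` is unitary, the
error of keeping a finite set of pairs is at most the probability left out (`norm_exp_sub_sum_le`).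
A Chernoff bound for the difference of the two variables shows that `|j - k| ≤ d` suffices for some
`d` of order `√(τ log (1/ε)) + log (1/ε)` (`exists_finset_poissonWeight`). This square root is the
source of the query count.

Half of the truncated sum, times `z^d`, is a polynomial `P` of degree at most `2d` with `|P| < 1` on
the circle. Fejér–Riesz supplies `Q` with `|P|² + |Q|² = 1` there, and peeling off one degree at a
time writes `(P, Q)` as a product of one-qubit unitaries and factors `diag (z, 1)`
(`signalProcessable_of_norm_sq_add`). Replacing each factor by a controlled `W` yields a circuit for
`P(W)`; then `d` controlled copies of `W⁻¹` remove the shift, and the subnormalization factor is 2.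
One ancilla is the control, and two more are borrowed by the multiply controlled NOT inside the
reflection. -/

theorem infinite_norm_eq_one : {z : ℂ | ‖z‖ = 1}.Infinite := by
  have hx : ∀ n : ℕ, (1 / ((n : ℝ) + 1)) ^ 2 ≤ 1 := fun n => by
    have h1 : 1 / ((n : ℝ) + 1) ≤ 1 := by
      rw [div_le_one (by positivity)]; linarith [(n.cast_nonneg : (0 : ℝ) ≤ n)]
    exact pow_le_one₀ (by positivity) h1
  refine Set.infinite_of_injective_forall_mem
    (f := fun n : ℕ => (⟨1 / ((n : ℝ) + 1), √(1 - (1 / ((n : ℝ) + 1)) ^ 2)⟩ : ℂ)) ?_ ?_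
  · intro a b hab
    have := congrArg Complex.re hab
    simpa using this
  · intro n
    have h := Real.mul_self_sqrt (sub_nonneg.2 (hx n))
    have h2 : Complex.normSq (⟨1 / ((n : ℝ) + 1), √(1 - (1 / ((n : ℝ) + 1)) ^ 2)⟩ : ℂ) = 1 := by
      rw [Complex.normSq_mk, h]; ring
    show ‖_‖ = (1 : ℝ)
    rw [Complex.norm_def, h2, Real.sqrt_one]

theorem eq_of_eval_eq_on_circle {p q : ℂ[X]} (h : ∀ z : ℂ, ‖z‖ = 1 → p.eval z = q.eval z) :
    p = q :=
  eq_of_infinite_eval_eq p q (infinite_norm_eq_one.mono fun z hz => h z hz)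

theorem mul_conj_of_norm_eq_one {z : ℂ} (hz : ‖z‖ = 1) : z * conj z = 1 := by
  rw [Complex.mul_conj, Complex.normSq_eq_norm_sq, hz]; simp

/-- The conjugate reciprocal `z ^ n * conj (P (1 / conj z))` of a polynomial of degree at
most `n`. -/
noncomputable def conjReflect (n : ℕ) (P : ℂ[X]) : ℂ[X] := reflect n (P.map (starRingEnd ℂ))

theorem eval_conjReflect' {n : ℕ} {P : ℂ[X]} (hP : P.natDegree ≤ n) {z w : ℂ}
    (hz : z * conj w = 1) : (conjReflect n P).eval z = z ^ n * conj (P.eval w) := by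
  have hw : conj w * z = 1 := by rw [mul_comm, hz]
  let : Invertible (conj w) := ⟨z, hz, hw⟩
  have h := eval₂_reflect_mul_pow (RingHom.id ℂ) (conj w) n (P.map (starRingEnd ℂ))
    (natDegree_map_le.trans hP)
  have h3 : (P.map (starRingEnd ℂ)).eval (conj w) = conj (P.eval w) := by
    rw [eval_map, eval₂_at_apply]
  change (conjReflect n P).eval z * (conj w) ^ n = (P.map (starRingEnd ℂ)).eval (conj w) at h
  rw [h3] at h
  rw [← h, mul_comm, mul_assoc, ← mul_pow, hw, one_pow, mul_one]

theorem eval_conjReflect {n : ℕ} {P : ℂ[X]} (hP : P.natDegree ≤ n) {z : ℂ} (hz : ‖z‖ = 1) :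
    (conjReflect n P).eval z = z ^ n * conj (P.eval z) :=
  eval_conjReflect' hP (mul_conj_of_norm_eq_one hz)

theorem natDegree_conjReflect_le {n : ℕ} {P : ℂ[X]} (hP : P.natDegree ≤ n) :
    (conjReflect n P).natDegree ≤ n :=
  natDegree_reflect_le.trans (max_le le_rfl (natDegree_map_le.trans hP))

theorem coeff_conjReflect_zero (n : ℕ) (P : ℂ[X]) :
    (conjReflect n P).coeff 0 = conj (P.coeff n) := by
  simp [conjReflect, coeff_reflect]

/-- **Fejér–Riesz**, for strictly positive trigonometric polynomials. -/
theorem fejer_riesz : ∀ (n : ℕ) (p : ℂ[X]), p.natDegree ≤ 2 * n →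
    (∀ z : ℂ, ‖z‖ = 1 → ∃ r : ℝ, 0 < r ∧ p.eval z = r * z ^ n) →
    ∃ q : ℂ[X], q.natDegree ≤ n ∧
      ∀ z : ℂ, ‖z‖ = 1 → p.eval z = ((‖q.eval z‖ ^ 2 : ℝ) : ℂ) * z ^ n := by
  intro n
  induction n with
  | zero =>
    intro p hdeg hpos
    obtain ⟨c, hc⟩ : ∃ c, p = C c := ⟨_, eq_C_of_natDegree_le_zero (by simpa using hdeg)⟩
    subst hc
    obtain ⟨r, hr, hr2⟩ := hpos 1 (by simp)
    refine ⟨C ((√r : ℝ) : ℂ), by simp, fun z _ => ?_⟩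
    simp only [eval_C, pow_zero, mul_one] at hr2 ⊢
    rw [hr2, Complex.norm_real, Real.norm_eq_abs, sq_abs, Real.sq_sqrt hr.le]
  | succ n ih =>
    intro p hdeg hpos
    -- Realness on the circle makes `p` equal to its own conjugate reciprocal, so its roots come in
    -- pairs `r`, `1 / conj r`.
    have hsymm : conjReflect (2 * (n + 1)) p = p := by
      refine eq_of_eval_eq_on_circle fun z hz => ?_
      obtain ⟨r, -, hr⟩ := hpos z hz
      rw [eval_conjReflect hdeg hz, hr, map_mul, Complex.conj_ofReal, map_pow]
      have h1 := mul_conj_of_norm_eq_one hz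
      calc z ^ (2 * (n + 1)) * (r * conj z ^ (n + 1))
          = r * z ^ (n + 1) * (z * conj z) ^ (n + 1) := by ring
        _ = _ := by rw [h1]; ring
    have htop : p.coeff 0 = conj (p.coeff (2 * (n + 1))) := by
      conv_lhs => rw [← hsymm]
      exact coeff_conjReflect_zero _ _
    have hp0 : p ≠ 0 := by
      rintro rfl
      obtain ⟨r, hr, hr2⟩ := hpos 1 (by simp)
      simp at hr2
      exact hr.ne (by exact_mod_cast hr2)
    -- A zero constant term forces a zero top coefficient, so dividing by `X` lowers the degree
    -- bound by two. Otherwise a pair of nonzero roots is split off.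
    by_cases h0 : p.coeff 0 = 0
    · have hp : p = X * p.divX := by
        conv_lhs => rw [← divX_mul_X_add p, h0]
        simp [mul_comm]
      have hlt : p.natDegree < 2 * (n + 1) := by
        refine lt_of_le_of_ne hdeg fun h => ?_
        rw [h0, ← h] at htop
        have := (map_eq_zero _).1 htop.symm
        exact hp0 (leadingCoeff_eq_zero.1 this)
      obtain ⟨q, hq, hq2⟩ := ih p.divX (by rw [natDegree_divX_eq_natDegree_tsub_one]; omega)
        (fun z hz => by
          obtain ⟨r, hr, hr2⟩ := hpos z hz
          have hz0 : z ≠ 0 := by rintro rfl; simp at hz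
          refine ⟨r, hr, mul_left_cancel₀ hz0 ?_⟩
          rw [hp, eval_mul, eval_X] at hr2
          rw [hr2]; ring)
      refine ⟨q, hq.trans (by omega), fun z hz => ?_⟩
      rw [hp, eval_mul, eval_X, hq2 z hz]; ring
    · have hdeg0 : p.degree ≠ 0 := by
        intro h
        have hd : p.natDegree = 0 := natDegree_eq_of_degree_eq_some h
        have : p.coeff (2 * (n + 1)) = 0 := coeff_eq_zero_of_natDegree_lt (by omega)
        rw [this, map_zero] at htop
        exact h0 htop
      obtain ⟨r, hr⟩ := IsAlgClosed.exists_root p hdeg0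
      have hr0 : r ≠ 0 := by
        rintro rfl
        exact h0 (by rw [coeff_zero_eq_eval_zero]; exact hr)
      have hcr0 : conj r ≠ 0 := (_root_.map_ne_zero _).2 hr0
      -- Strict positivity excludes roots on the circle. Hence `r` and `1 / conj r` are distinct and
      -- both divide out, with no discussion of even multiplicities.
      have hr1 : ‖r‖ ≠ 1 := by
        intro h
        obtain ⟨s, hs, hs2⟩ := hpos r h
        rw [hr.eq_zero] at hs2
        have := mul_ne_zero (Complex.ofReal_ne_zero.2 hs.ne') (pow_ne_zero (n + 1) hr0)
        exact this hs2.symm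
      have hr' : p.eval (conj r)⁻¹ = 0 := by
        rw [← hsymm, eval_conjReflect' hdeg (w := r) (inv_mul_cancel₀ hcr0), hr.eq_zero]
        simp
      obtain ⟨p1, hp1⟩ := dvd_iff_isRoot.2 hr
      have hp1r : p1.eval (conj r)⁻¹ = 0 := by
        rw [hp1, eval_mul] at hr'
        refine (mul_eq_zero.1 hr').resolve_left ?_
        simp only [eval_sub, eval_X, eval_C]
        intro h
        have h2 : conj r * r = 1 := by
          have h3 := sub_eq_zero.1 h
          calc conj r * r = conj r * (conj r)⁻¹ := by rw [h3]
            _ = 1 := mul_inv_cancel₀ hcr0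
        rw [mul_comm, Complex.mul_conj, Complex.normSq_eq_norm_sq] at h2
        have h3 : ‖r‖ ^ 2 = 1 := by exact_mod_cast h2
        exact hr1 ((pow_eq_one_iff_of_nonneg (norm_nonneg _) two_ne_zero).1 h3)
      obtain ⟨p2, hp2⟩ := dvd_iff_isRoot.2 (show p1.IsRoot _ from hp1r)
      -- This scaling turns the two linear factors into `(X - r)(1 - conj r X)`, which equals `z |z
      -- - r|²` on the circle; the quotient therefore remains positive.
      set p3 : ℂ[X] := C (-(conj r)⁻¹) * p2 with hp3
      have hp : p = (X - C r) * (1 - C (conj r) * X) * p3 := by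
        have : (1 - C (conj r) * X) * C (-(conj r)⁻¹) = X - C (conj r)⁻¹ := by
          have hC : C (conj r) * C (conj r)⁻¹ = (1 : ℂ[X]) := by
            rw [← C_mul, mul_inv_cancel₀ hcr0, C_1]
          rw [C_neg]
          linear_combination X * hC
        rw [hp3, mul_assoc, ← mul_assoc (1 - C (conj r) * X), this, ← hp2, ← hp1]
      have hp30 : p3 ≠ 0 := by
        rintro h
        rw [h, mul_zero] at hp
        exact hp0 hp
      have hfac : (1 - C (conj r) * X : ℂ[X]) = C (-conj r) * (X - C (conj r)⁻¹) := by
        have hC : C (conj r) * C (conj r)⁻¹ = (1 : ℂ[X]) := by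
          rw [← C_mul, mul_inv_cancel₀ hcr0, C_1]
        rw [C_neg]
        linear_combination -hC
      have hd3 : p.natDegree = p3.natDegree + 2 := by
        rw [hp, hfac, natDegree_mul (mul_ne_zero (X_sub_C_ne_zero _)
          (mul_ne_zero (C_ne_zero.2 (neg_ne_zero.2 hcr0)) (X_sub_C_ne_zero _))) hp30,
          natDegree_mul (X_sub_C_ne_zero _)
          (mul_ne_zero (C_ne_zero.2 (neg_ne_zero.2 hcr0)) (X_sub_C_ne_zero _)),
          natDegree_C_mul (neg_ne_zero.2 hcr0), natDegree_X_sub_C, natDegree_X_sub_C]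
        omega
      have hev : ∀ z : ℂ, ‖z‖ = 1 →
          p.eval z = ((‖z - r‖ ^ 2 : ℝ) : ℂ) * z * p3.eval z := by
        intro z hz
        have h1 := mul_conj_of_norm_eq_one hz
        rw [hp, eval_mul, eval_mul]
        congr 1
        rw [← Complex.normSq_eq_norm_sq, ← Complex.mul_conj]
        simp only [eval_sub, eval_X, eval_C, eval_mul, eval_one, map_sub]
        linear_combination (r - z) * h1
      have hpos3 : ∀ z : ℂ, ‖z‖ = 1 → 0 < ‖z - r‖ ^ 2 := fun z hz => by
        have : z - r ≠ 0 := sub_ne_zero.2 (by rintro rfl; exact hr1 hz)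
        positivity
      obtain ⟨q, hq, hq2⟩ := ih p3 (by omega) (fun z hz => by
        obtain ⟨s, hs, hs2⟩ := hpos z hz
        have hz0 : z ≠ 0 := by rintro rfl; simp at hz
        have hn := hpos3 z hz
        have hn' : ((‖z - r‖ ^ 2 : ℝ) : ℂ) ≠ 0 := Complex.ofReal_ne_zero.2 hn.ne'
        refine ⟨s / ‖z - r‖ ^ 2, by positivity, mul_left_cancel₀ (mul_ne_zero hn' hz0) ?_⟩
        rw [← hev z hz, hs2, Complex.ofReal_div]
        field_simp
        ring)
      refine ⟨(X - C r) * q, (natDegree_mul_le).trans (by rw [natDegree_X_sub_C]; omega),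
        fun z hz => ?_⟩
      rw [hev z hz, hq2 z hz, eval_mul, norm_mul, mul_pow, eval_sub, eval_X, eval_C]
      push_cast
      ring

/-- On the circle `X^n - P * conjReflect n P` is `z^n (1 - |P|²)`, so Fejér–Riesz applies; the
strict bound on `P` is what makes it positive. -/
theorem exists_complementary_polynomial {n : ℕ} {P : ℂ[X]} (hP : P.natDegree ≤ n)
    (hlt : ∀ z : ℂ, ‖z‖ = 1 → ‖P.eval z‖ < 1) :
    ∃ Q : ℂ[X], Q.natDegree ≤ n ∧
      ∀ z : ℂ, ‖z‖ = 1 → ‖P.eval z‖ ^ 2 + ‖Q.eval z‖ ^ 2 = 1 := by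
  have hev : ∀ z : ℂ, ‖z‖ = 1 → (X ^ n - P * conjReflect n P).eval z =
      ((1 - ‖P.eval z‖ ^ 2 : ℝ) : ℂ) * z ^ n := fun z hz => by
    rw [eval_sub, eval_mul, eval_conjReflect hP hz, eval_pow, eval_X]
    push_cast
    rw [← Complex.ofReal_pow, ← Complex.normSq_eq_norm_sq, ← Complex.mul_conj]
    ring
  obtain ⟨Q, hQ, hQ2⟩ := fejer_riesz n (X ^ n - P * conjReflect n P)
    ((natDegree_sub_le _ _).trans (max_le (by rw [natDegree_X_pow]; omega)
      (natDegree_mul_le.trans (by have := natDegree_conjReflect_le hP; omega))))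
    (fun z hz => ⟨_, sub_pos.2 (pow_lt_one₀ (norm_nonneg _) (hlt z hz) two_ne_zero), hev z hz⟩)
  refine ⟨Q, hQ, fun z hz => ?_⟩
  have hz0 : z ≠ 0 := by rintro rfl; simp at hz
  have h := (hev z hz).symm.trans (hQ2 z hz)
  have := Complex.ofReal_injective (mul_right_cancel₀ (pow_ne_zero n hz0) h)
  linarith

/-- The matrix with rows `(a, -conj b)` and `(b, conj a)`. -/
def rotationMatrix (a b : ℂ) : Matrix Bool Bool ℂ :=
  Matrix.of fun i j => bif i then (bif j then conj a else b) else (bif j then -conj b else a)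

theorem rotationMatrix_mem {a b : ℂ} (h : ‖a‖ ^ 2 + ‖b‖ ^ 2 = 1) :
    rotationMatrix a b ∈ Matrix.unitaryGroup Bool ℂ := by
  have h' : a * conj a + b * conj b = 1 := by
    rw [Complex.mul_conj, Complex.mul_conj, Complex.normSq_eq_norm_sq, Complex.normSq_eq_norm_sq]
    exact_mod_cast h
  rw [Matrix.mem_unitaryGroup_iff]
  ext i j
  rw [Matrix.star_eq_conjTranspose, Matrix.mul_apply, Fintype.sum_bool]
  cases i <;> cases j <;>
    simp [rotationMatrix, Matrix.conjTranspose_apply] <;> first | linear_combination h' | ring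

/-- The pairs of polynomials that arise in the first column of a product of `n` factors
`diag (z, 1)` interleaved with `n + 1` unitaries. -/
inductive SignalProcessable : ℕ → ℂ[X] → ℂ[X] → Prop
  | base (V : Matrix.unitaryGroup Bool ℂ) :
      SignalProcessable 0 (C ((V : Matrix Bool Bool ℂ) false false))
        (C ((V : Matrix Bool Bool ℂ) true false))
  | step {n : ℕ} {P Q : ℂ[X]} (V : Matrix.unitaryGroup Bool ℂ) (h : SignalProcessable n P Q) :
      SignalProcessable (n + 1)
        (C ((V : Matrix Bool Bool ℂ) false false) * (X * P)
          + C ((V : Matrix Bool Bool ℂ) false true) * Q)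
        (C ((V : Matrix Bool Bool ℂ) true false) * (X * P)
          + C ((V : Matrix Bool Bool ℂ) true true) * Q)

/-- The unit vector is `(p₁, q₁)` normalised, or one orthogonal to `(p₀, q₀)` when `(p₁, q₁)`
vanishes. It gives the rotation that kills a constant coefficient and a top coefficient at once. -/
theorem exists_unit_of_orthogonal {p₀ q₀ p₁ q₁ : ℂ} (h : p₀ * conj p₁ + q₀ * conj q₁ = 0) :
    ∃ a b : ℂ, ‖a‖ ^ 2 + ‖b‖ ^ 2 = 1 ∧ conj a * p₀ + conj b * q₀ = 0 ∧ -b * p₁ + a * q₁ = 0 := by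
  have key : ∀ u v : ℂ, (u ≠ 0 ∨ v ≠ 0) → conj u * p₀ + conj v * q₀ = 0 →
      -v * p₁ + u * q₁ = 0 → ∃ a b : ℂ, ‖a‖ ^ 2 + ‖b‖ ^ 2 = 1 ∧
        conj a * p₀ + conj b * q₀ = 0 ∧ -b * p₁ + a * q₁ = 0 := by
    intro u v huv h1 h2
    have hs : 0 < ‖u‖ ^ 2 + ‖v‖ ^ 2 := by
      rcases huv with h | h
      · have := norm_pos_iff.2 h; positivity
      · have := norm_pos_iff.2 h; positivity
    set s : ℝ := √(‖u‖ ^ 2 + ‖v‖ ^ 2) with hsdef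
    have hspos : 0 < s := Real.sqrt_pos.2 hs
    have hs2 : s ^ 2 = ‖u‖ ^ 2 + ‖v‖ ^ 2 := Real.sq_sqrt hs.le
    refine ⟨((s⁻¹ : ℝ) : ℂ) * u, ((s⁻¹ : ℝ) : ℂ) * v, ?_, ?_, ?_⟩
    · rw [norm_mul, norm_mul, Complex.norm_real, mul_pow, mul_pow, ← mul_add, ← hs2, Real.norm_eq_abs,
        sq_abs, ← mul_pow, inv_mul_cancel₀ hspos.ne', one_pow]
    · rw [map_mul, map_mul, Complex.conj_ofReal]
      linear_combination ((s⁻¹ : ℝ) : ℂ) * h1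
    · linear_combination ((s⁻¹ : ℝ) : ℂ) * h2
  by_cases h1 : p₁ ≠ 0 ∨ q₁ ≠ 0
  · exact key p₁ q₁ h1 (by linear_combination h) (by ring)
  · push Not at h1
    obtain ⟨rfl, rfl⟩ := h1
    by_cases h0 : p₀ ≠ 0 ∨ q₀ ≠ 0
    · refine key (-conj q₀) (conj p₀) ?_ ?_ (by ring)
      · rcases h0 with h | h
        · exact Or.inr ((_root_.map_ne_zero _).2 h)
        · exact Or.inl (neg_ne_zero.2 ((_root_.map_ne_zero _).2 h))
      · simp only [map_neg, Complex.conj_conj]; ring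
    · push Not at h0
      obtain ⟨rfl, rfl⟩ := h0
      exact key 1 0 (by simp) (by simp) (by simp)

/-- The norm identity says `P P~ + Q Q~ = X^(n+1)`, with `~` the conjugate reciprocal. Its constant
term makes the lowest and highest coefficient vectors of `(P, Q)` orthogonal, so one rotation
produces `(F, G)` with `X ∣ F` and `deg G ≤ n`. The pair `(F / X, G)` again has norm one on the
circle, and induction applies. -/
theorem signalProcessable_of_norm_sq_add : ∀ (n : ℕ) (P Q : ℂ[X]), P.natDegree ≤ n →
    Q.natDegree ≤ n → (∀ z : ℂ, ‖z‖ = 1 → ‖P.eval z‖ ^ 2 + ‖Q.eval z‖ ^ 2 = 1) →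
    SignalProcessable n P Q := by
  intro n
  induction n with
  | zero =>
    intro P Q hP hQ h
    rw [eq_C_of_natDegree_le_zero hP, eq_C_of_natDegree_le_zero hQ] at h ⊢
    have h1 : ‖P.coeff 0‖ ^ 2 + ‖Q.coeff 0‖ ^ 2 = 1 := by simpa using h 1 (by simp)
    exact SignalProcessable.base ⟨_, rotationMatrix_mem h1⟩
  | succ n ih =>
    intro P Q hP hQ h
    have hpoly : P * conjReflect (n + 1) P + Q * conjReflect (n + 1) Q = X ^ (n + 1) := by
      refine eq_of_eval_eq_on_circle fun z hz => ?_
      have h1 : P.eval z * conj (P.eval z) + Q.eval z * conj (Q.eval z) = 1 := by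
        rw [Complex.mul_conj, Complex.mul_conj, Complex.normSq_eq_norm_sq,
          Complex.normSq_eq_norm_sq]
        exact_mod_cast h z hz
      rw [eval_add, eval_mul, eval_mul, eval_conjReflect hP hz, eval_conjReflect hQ hz, eval_pow,
        eval_X]
      linear_combination z ^ (n + 1) * h1
    have horth : P.coeff 0 * conj (P.coeff (n + 1)) + Q.coeff 0 * conj (Q.coeff (n + 1)) = 0 := by
      have := congrArg (fun p : ℂ[X] => p.coeff 0) hpoly
      simpa [mul_coeff_zero, coeff_conjReflect_zero] using this
    obtain ⟨a, b, hab, hp, hq⟩ := exists_unit_of_orthogonal horth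
    have hab' : a * conj a + b * conj b = 1 := by
      rw [Complex.mul_conj, Complex.mul_conj, Complex.normSq_eq_norm_sq,
        Complex.normSq_eq_norm_sq]
      exact_mod_cast hab
    have hC : C a * C (conj a) + C b * C (conj b) = (1 : ℂ[X]) := by
      rw [← C_mul, ← C_mul, ← C_add, hab', C_1]
    set F : ℂ[X] := C (conj a) * P + C (conj b) * Q with hF
    set G : ℂ[X] := -C b * P + C a * Q with hG
    have hFX : F = X * F.divX := by
      have h0 : F.coeff 0 = 0 := by simpa [hF] using hp
      conv_lhs => rw [← divX_mul_X_add F, h0]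
      simp [mul_comm]
    have hFd : F.natDegree ≤ n + 1 :=
      natDegree_add_le_of_degree_le ((natDegree_C_mul_le _ _).trans hP)
        ((natDegree_C_mul_le _ _).trans hQ)
    have hGd : G.natDegree ≤ n := by
      have h1 : G.natDegree ≤ n + 1 := by
        rw [hG, ← C_neg]
        exact natDegree_add_le_of_degree_le ((natDegree_C_mul_le _ _).trans hP)
          ((natDegree_C_mul_le _ _).trans hQ)
      have h2 : G.coeff (n + 1) = 0 := by
        rw [hG, ← C_neg]
        simpa using hq
      refine natDegree_le_iff_coeff_eq_zero.2 fun k hk => ?_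
      rcases eq_or_lt_of_le (Nat.succ_le_of_lt hk) with rfl | hk'
      · exact h2
      · exact coeff_eq_zero_of_natDegree_lt (lt_of_le_of_lt h1 hk')
    have hrec := ih F.divX G (by rw [natDegree_divX_eq_natDegree_tsub_one]; omega) hGd
      (fun z hz => by
        have h1 : ‖F.divX.eval z‖ = ‖F.eval z‖ := by
          conv_rhs => rw [hFX, eval_mul, eval_X, norm_mul, hz, one_mul]
        rw [h1, ← h z hz]
        apply Complex.ofReal_injective
        simp only [← Complex.normSq_eq_norm_sq, Complex.ofReal_add, ← Complex.mul_conj]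
        simp only [hF, hG, eval_add, eval_mul, eval_C, eval_neg, map_add, map_mul, map_neg,
          Complex.conj_conj]
        linear_combination
          (P.eval z * conj (P.eval z) + Q.eval z * conj (Q.eval z)) * hab')
    have := SignalProcessable.step ⟨_, rotationMatrix_mem hab⟩ hrec
    rw [← hFX] at this
    convert this using 1
    · simp only [rotationMatrix, Matrix.of_apply, cond_false, cond_true, hF, hG, C_neg]
      linear_combination -P * hC
    · simp only [rotationMatrix, Matrix.of_apply, cond_false, cond_true, hF, hG]
      linear_combination -Q * hC

end Polynomials

/-! ### Poisson expansion of the exponential and its Chernoff truncation. -/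

section Truncation

/-- The joint weights of two independent Poisson variables of mean `τ / 2`. -/
noncomputable def poissonWeight (τ : ℝ) (x : ℕ × ℕ) : ℝ :=
  Real.exp (-τ) * ((τ / 2) ^ x.1 / x.1.factorial * ((τ / 2) ^ x.2 / x.2.factorial))

theorem poissonWeight_nonneg {τ : ℝ} (hτ : 0 ≤ τ) (x : ℕ × ℕ) : 0 ≤ poissonWeight τ x := by
  unfold poissonWeight; positivity

theorem hasSum_mul_of_nonneg {f g : ℕ → ℝ} {a b : ℝ} (hf : HasSum f a) (hg : HasSum g b)
    (hf0 : ∀ n, 0 ≤ f n) (hg0 : ∀ n, 0 ≤ g n) :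
    HasSum (fun x : ℕ × ℕ => f x.1 * g x.2) (a * b) :=
  HasSum.mul hf hg (hf.summable.mul_of_nonneg hg.summable hf0 hg0)

theorem hasSum_pow_div_factorial (u : ℝ) :
    HasSum (fun n : ℕ => u ^ n / n.factorial) (Real.exp u) := by
  rw [Real.exp_eq_exp_ℝ]
  exact NormedSpace.expSeries_div_hasSum_exp u

theorem hasSum_pow_div_factorial_mul {u v : ℝ} (hu : 0 ≤ u) (hv : 0 ≤ v) :
    HasSum (fun x : ℕ × ℕ => u ^ x.1 / x.1.factorial * (v ^ x.2 / x.2.factorial))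
      (Real.exp u * Real.exp v) :=
  hasSum_mul_of_nonneg (f := fun n => u ^ n / n.factorial) (g := fun n => v ^ n / n.factorial)
    (hasSum_pow_div_factorial u) (hasSum_pow_div_factorial v)
    (fun n => by positivity) (fun n => by positivity)

/-- The moment generating function of the difference of the two Poisson variables, factored by
independence. -/
theorem hasSum_poissonWeight_mul_exp {τ : ℝ} (hτ : 0 ≤ τ) (s : ℝ) :
    HasSum (fun x : ℕ × ℕ => poissonWeight τ x * Real.exp (s * (x.1 - x.2)))
      (Real.exp (τ * (Real.cosh s - 1))) := by
  have h := (hasSum_pow_div_factorial_mul (u := τ / 2 * Real.exp s) (v := τ / 2 * Real.exp (-s))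
    (by positivity) (by positivity)).mul_left (Real.exp (-τ))
  have hfun : ∀ x : ℕ × ℕ, poissonWeight τ x * Real.exp (s * (x.1 - x.2)) =
      Real.exp (-τ) * ((τ / 2 * Real.exp s) ^ x.1 / x.1.factorial *
        ((τ / 2 * Real.exp (-s)) ^ x.2 / x.2.factorial)) := fun x => by
    have : Real.exp (s * (x.1 - x.2)) = Real.exp s ^ x.1 * Real.exp (-s) ^ x.2 := by
      rw [← Real.exp_nat_mul, ← Real.exp_nat_mul, ← Real.exp_add]; ring_nf
    rw [this, poissonWeight, mul_pow, mul_pow]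
    ring
  have hval : Real.exp (τ * (Real.cosh s - 1)) =
      Real.exp (-τ) * (Real.exp (τ / 2 * Real.exp s) * Real.exp (τ / 2 * Real.exp (-s))) := by
    rw [← Real.exp_add, ← Real.exp_add, Real.cosh_eq]; ring_nf
  rw [hval, funext hfun]
  exact h

theorem hasSum_poissonWeight {τ : ℝ} (hτ : 0 ≤ τ) : HasSum (poissonWeight τ) 1 := by
  simpa using hasSum_poissonWeight_mul_exp hτ 0

/-- With `cosh s - 1 ≤ s²` on `[0, 1]`, the nearly optimal choice is `s = √(L / τ)`, capped at 1.
The cap accounts for the summand `2 * L` in `d`, the other case for `2 * √(τ * L)`. -/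
theorem exists_chernoff_parameter {τ L d : ℝ} (hτ : 0 ≤ τ) (hL : 0 < L)
    (hd : 2 * √(τ * L) + 2 * L ≤ d) :
    ∃ s : ℝ, 0 ≤ s ∧ τ * (Real.cosh s - 1) - s * d ≤ -L := by
  have hcosh : ∀ s : ℝ, 0 ≤ s → s ≤ 1 → Real.cosh s - 1 ≤ s ^ 2 := fun s hs hs1 => by
    have h1 := Real.cosh_le_exp_half_sq s
    have h2 : |s ^ 2 / 2| ≤ 1 := by
      rw [abs_of_nonneg (by positivity)]; nlinarith
    have h3 := (le_abs_self _).trans (Real.abs_exp_sub_one_le h2)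
    rw [abs_of_nonneg (by positivity)] at h3
    linarith
  have hsq := Real.sqrt_nonneg (τ * L)
  rcases le_or_gt τ L with h | h
  · refine ⟨1, zero_le_one, ?_⟩
    have := mul_le_mul_of_nonneg_left (hcosh 1 zero_le_one le_rfl) hτ
    linarith
  · have hτ0 : 0 < τ := hL.trans h
    have hs0 : 0 ≤ √(L / τ) := Real.sqrt_nonneg _
    refine ⟨√(L / τ), hs0, ?_⟩
    have h1 := mul_le_mul_of_nonneg_left
      (hcosh _ hs0 (Real.sqrt_le_one.2 ((div_le_one hτ0).2 h.le))) hτ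
    rw [Real.sq_sqrt (by positivity), mul_div_cancel₀ _ hτ0.ne'] at h1
    have h2 : √(L / τ) * √(τ * L) = L := by
      rw [← Real.sqrt_mul (by positivity), show L / τ * (τ * L) = L ^ 2 by field_simp,
        Real.sqrt_sq hL.le]
    have h3 := mul_le_mul_of_nonneg_left hd hs0
    have h4 : √(L / τ) * (2 * √(τ * L) + 2 * L) = 2 * L + √(L / τ) * (2 * L) := by
      linear_combination 2 * h2
    have h5 : 0 ≤ √(L / τ) * (2 * L) := by positivity
    linarith

theorem exists_finset_poissonWeight {τ ε : ℝ} {d : ℕ} (hτ : 0 ≤ τ) (hε : 0 < ε) (hε1 : ε < 1)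
    (hd : 2 * √(τ * Real.log (4 / ε)) + 2 * Real.log (4 / ε) ≤ d) :
    ∃ S : Finset (ℕ × ℕ), (∀ x ∈ S, x.1 ≤ d + x.2 ∧ x.2 ≤ d + x.1) ∧
      1 - ε ≤ ∑ x ∈ S, poissonWeight τ x := by
  classical
  obtain ⟨s, hs, hsd⟩ := exists_chernoff_parameter hτ
    (Real.log_pos (by rw [lt_div_iff₀ hε]; linarith)) hd
  -- The error budget: `ε / 2` for passing to a finite set, and `ε / 4` for each of the two tails,
  -- whence the 4 in `log (4 / ε)`.
  obtain ⟨T, hT⟩ := ((hasSum_poissonWeight hτ).eventually_const_lt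
    (show 1 - ε / 2 < 1 by linarith)).exists
  set p : ℕ × ℕ → Prop := fun x => x.1 ≤ d + x.2 ∧ x.2 ≤ d + x.1 with hp
  refine ⟨T.filter p, fun x hx => (Finset.mem_filter.1 hx).2, ?_⟩
  have hsplit := Finset.sum_filter_add_sum_filter_not T p (poissonWeight τ)
  have htail : ∑ x ∈ T with ¬ p x, poissonWeight τ x ≤ ε / 2 := by
    have h1 := hasSum_poissonWeight_mul_exp hτ s
    have h2 := hasSum_poissonWeight_mul_exp hτ (-s)
    rw [Real.cosh_neg] at h2
    have h3 := (h1.add h2).mul_left (Real.exp (-(s * d)))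
    have hle : ∑ x ∈ T with ¬ p x, poissonWeight τ x ≤
        ∑ x ∈ T with ¬ p x, Real.exp (-(s * d)) *
          (poissonWeight τ x * Real.exp (s * (x.1 - x.2))
            + poissonWeight τ x * Real.exp (-s * (x.1 - x.2))) := by
      refine Finset.sum_le_sum fun x hx => ?_
      have hx2 : ¬ p x := (Finset.mem_filter.1 hx).2
      have hw := poissonWeight_nonneg hτ x
      have hkey : 1 ≤ Real.exp (-(s * d)) *
          (Real.exp (s * (x.1 - x.2)) + Real.exp (-s * (x.1 - x.2))) := by
        rw [mul_add, ← Real.exp_add, ← Real.exp_add]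
        rw [hp] at hx2
        simp only [not_and_or, not_le] at hx2
        rcases hx2 with h | h
        · have h' : (d : ℝ) + x.2 ≤ x.1 := by exact_mod_cast h.le
          have : 1 ≤ Real.exp (-(s * d) + s * (x.1 - x.2)) := Real.one_le_exp (by nlinarith)
          have := Real.exp_pos (-(s * d) + -s * (x.1 - x.2))
          linarith
        · have h' : (d : ℝ) + x.1 ≤ x.2 := by exact_mod_cast h.le
          have : 1 ≤ Real.exp (-(s * d) + -s * (x.1 - x.2)) := Real.one_le_exp (by nlinarith)
          have := Real.exp_pos (-(s * d) + s * (x.1 - x.2))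
          linarith
      calc poissonWeight τ x = poissonWeight τ x * 1 := (mul_one _).symm
        _ ≤ poissonWeight τ x * _ := mul_le_mul_of_nonneg_left hkey hw
        _ = _ := by ring
    refine hle.trans ((sum_le_hasSum _ (fun x _ => ?_) h3).trans ?_)
    · have hw := poissonWeight_nonneg hτ x
      positivity
    · rw [← two_mul, mul_left_comm, ← Real.exp_add]
      have : Real.exp (-(s * d) + τ * (Real.cosh s - 1)) ≤ Real.exp (-Real.log (4 / ε)) :=
        Real.exp_le_exp.2 (by linarith)
      rw [Real.exp_neg, Real.exp_log (by positivity), inv_div] at this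
      linarith
  linarith

variable {𝔸 : Type*} [NormedRing 𝔸] [CompleteSpace 𝔸]

theorem hasSum_mul_of_summable_norm {f g : ℕ → 𝔸} {a b : 𝔸} (hf : HasSum f a) (hg : HasSum g b)
    (hf0 : Summable fun n => ‖f n‖) (hg0 : Summable fun n => ‖g n‖) :
    HasSum (fun x : ℕ × ℕ => f x.1 * g x.2) (a * b) :=
  HasSum.mul hf hg (summable_mul_of_summable_norm hf0 hg0)

variable [NormedAlgebra ℂ 𝔸]

theorem hasSum_exp_smul_mul {w w' : 𝔸} (hw : ∀ k, ‖w ^ k‖ ≤ 1) (hw' : ∀ k, ‖w' ^ k‖ ≤ 1)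
    (u : ℝ) :
    HasSum (fun x : ℕ × ℕ => ((u ^ x.1 / x.1.factorial * (u ^ x.2 / x.2.factorial) : ℝ) : ℂ) •
      (w ^ x.1 * w' ^ x.2)) (NormedSpace.exp ((u : ℂ) • w) * NormedSpace.exp ((u : ℂ) • w')) := by
  have key : ∀ v : 𝔸, (∀ k, ‖v ^ k‖ ≤ 1) →
      HasSum (fun k : ℕ => ((u ^ k / k.factorial : ℝ) : ℂ) • v ^ k)
        (NormedSpace.exp ((u : ℂ) • v)) ∧
      Summable (fun k : ℕ => ‖((u ^ k / k.factorial : ℝ) : ℂ) • v ^ k‖) := by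
    intro v hv
    constructor
    · have := NormedSpace.exp_series_hasSum_exp' (𝕂 := ℂ) ((u : ℂ) • v)
      convert this using 1
      ext k
      rw [smul_pow, smul_smul]
      congr 1
      push_cast
      rw [div_eq_inv_mul]
    · refine Summable.of_nonneg_of_le (fun k => norm_nonneg _) (fun k => ?_)
        (Real.summable_pow_div_factorial |u|)
      rw [norm_smul, Complex.norm_real, Real.norm_eq_abs, abs_div, abs_pow, Nat.abs_cast]
      exact mul_le_of_le_one_right (by positivity) (hv k)
  obtain ⟨h1, s1⟩ := key w hw
  obtain ⟨h2, s2⟩ := key w' hw'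
  have := hasSum_mul_of_summable_norm h1 h2 s1 s2
  convert this using 1
  ext x
  rw [smul_mul_smul_comm, ← Complex.ofReal_mul]

/-- The exponential is the full signed sum because `w` and `w'` commute. Every omitted term has norm
at most its weight, and the weights have total mass 1. -/
theorem norm_exp_sub_sum_le {τ : ℝ} (hτ : 0 ≤ τ) {w w' : 𝔸} (hcomm : Commute w w')
    (hw : ∀ k, ‖w ^ k‖ ≤ 1) (hw' : ∀ k, ‖w' ^ k‖ ≤ 1) (S : Finset (ℕ × ℕ)) :
    ‖NormedSpace.exp ((-(τ / 2 : ℝ) : ℂ) • (2 + w + w')) -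
        ∑ x ∈ S, (((-1) ^ (x.1 + x.2) * poissonWeight τ x : ℝ) : ℂ) • (w ^ x.1 * w' ^ x.2)‖ ≤
      1 - ∑ x ∈ S, poissonWeight τ x := by
  classical
  let : NormedAlgebra ℚ 𝔸 := NormedAlgebra.restrictScalars ℚ ℂ 𝔸
  have hexp : NormedSpace.exp ((-(τ / 2 : ℝ) : ℂ) • (2 + w + w')) =
      (Real.exp (-τ) : ℂ) • (NormedSpace.exp (((-(τ / 2) : ℝ) : ℂ) • w) *
        NormedSpace.exp (((-(τ / 2) : ℝ) : ℂ) • w')) := by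
    have h1 : (-(τ / 2 : ℝ) : ℂ) • (2 + w + w') = algebraMap ℂ 𝔸 (-τ) +
        (((-(τ / 2) : ℝ) : ℂ) • w + ((-(τ / 2) : ℝ) : ℂ) • w') := by
      have h2 : (2 : 𝔸) = (2 : ℂ) • 1 := by rw [← Algebra.algebraMap_eq_smul_one, map_ofNat]
      rw [Algebra.algebraMap_eq_smul_one, h2, add_assoc, smul_add, smul_add, smul_smul]
      push_cast
      congr 2
      ring
    rw [h1, NormedSpace.exp_add_of_commute (Algebra.commutes _ _),
      NormedSpace.exp_add_of_commute ((hcomm.smul_left _).smul_right _),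
      ← NormedSpace.algebraMap_exp_comm, ← Complex.exp_eq_exp_ℂ, ← Algebra.smul_def]
    push_cast
    rfl
  have hF : HasSum (fun x : ℕ × ℕ => (((-1) ^ (x.1 + x.2) * poissonWeight τ x : ℝ) : ℂ) •
      (w ^ x.1 * w' ^ x.2)) (NormedSpace.exp ((-(τ / 2 : ℝ) : ℂ) • (2 + w + w'))) := by
    rw [hexp]
    convert (hasSum_exp_smul_mul hw hw' (-(τ / 2))).const_smul (Real.exp (-τ) : ℂ) using 1
    ext x
    rw [smul_smul, ← Complex.ofReal_mul]
    congr 2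
    rw [poissonWeight, neg_pow (τ / 2) x.1, neg_pow (τ / 2) x.2, pow_add]
    ring
  have hf := hasSum_poissonWeight hτ
  have hF' : Filter.Tendsto (fun T : Finset (ℕ × ℕ) => ∑ x ∈ T,
      (((-1) ^ (x.1 + x.2) * poissonWeight τ x : ℝ) : ℂ) • (w ^ x.1 * w' ^ x.2)) Filter.atTop
      (nhds (NormedSpace.exp ((-(τ / 2 : ℝ) : ℂ) • (2 + w + w')))) := hF
  -- It suffices to bound the finite sums over supersets of `S`, uniformly, and pass to the limit.
  refine le_of_tendsto (hF'.sub_const _).norm ?_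
  filter_upwards [Filter.eventually_ge_atTop S] with T hT
  rw [← Finset.sum_sdiff hT, add_sub_cancel_right]
  have h1 : ∑ x ∈ T \ S, poissonWeight τ x ≤ 1 - ∑ x ∈ S, poissonWeight τ x := by
    have h2 := Finset.sum_sdiff hT (f := poissonWeight τ)
    have h3 := sum_le_hasSum T (fun x _ => poissonWeight_nonneg hτ x) hf
    linarith
  refine (norm_sum_le_of_le _ fun x _ => ?_).trans h1
  rw [norm_smul, Complex.norm_real, norm_mul, norm_pow, norm_neg, norm_one, one_pow, one_mul,
    Real.norm_eq_abs, abs_of_nonneg (poissonWeight_nonneg hτ x)]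
  refine mul_le_of_le_one_right (poissonWeight_nonneg hτ x) ((norm_mul_le _ _).trans ?_)
  exact mul_le_one₀ (hw _) (norm_nonneg _) (hw' _)

end Truncation

/-! ### Elementary gates, multiply controlled NOT with borrowed qubits, and the reflection about
zero. -/

section Gates

open Function Matrix

variable {W : Type} [DecidableEq W]

/-- Flip the qubit `x` if `d` holds. -/
def flipIf (x : W) (d : (W → Bool) → Bool) (s : W → Bool) : W → Bool :=
  update s x (xor (s x) (d s))

theorem flipIf_involutive {x : W} {d : (W → Bool) → Bool}
    (hd : ∀ s b, d (update s x b) = d s) : Involutive (flipIf x d) := by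
  intro s
  simp [flipIf, hd]

variable [Fintype W]

/-- The operator `V` on the qubit `w`, for a `2 × 2` matrix `V` that need not be unitary. -/
def singleMatrix (w : W) (V : Matrix Bool Bool ℂ) : Matrix (W → Bool) (W → Bool) ℂ :=
  Matrix.of fun p q => if p = update q w (p w) then V (p w) (q w) else 0

theorem singleMatrix_mulVec (w : W) (V : Matrix Bool Bool ℂ) (ψ : (W → Bool) → ℂ)
    (p : W → Bool) : (singleMatrix w V *ᵥ ψ) p = ∑ b, V (p w) b * ψ (update p w b) := by
  have hinj : Set.InjOn (fun b : Bool => update p w b) (Finset.univ : Finset Bool) :=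
    fun a _ b _ h => update_injective p w h
  have h1 : ∑ q ∈ Finset.univ.image (fun b : Bool => update p w b), singleMatrix w V p q * ψ q =
      ∑ b, V (p w) b * ψ (update p w b) := by
    rw [Finset.sum_image hinj]
    refine Finset.sum_congr rfl fun b _ => ?_
    simp [singleMatrix]
  rw [← h1]
  refine (Finset.sum_subset (Finset.subset_univ _) fun q _ hq => ?_).symm
  have : ¬ p = update q w (p w) := fun h => hq (Finset.mem_image.2 ⟨q w, Finset.mem_univ _, by
    rw [h]; simp⟩)
  simp [singleMatrix, this]

theorem ext_mulVec {n : Type} [Fintype n] {A B : Matrix n n ℂ}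
    (h : ∀ ψ p, (A *ᵥ ψ) p = (B *ᵥ ψ) p) : A = B :=
  Matrix.mulVec_injective (funext fun ψ => funext fun p => h ψ p)

theorem singleMatrix_mul (w : W) (V V' : Matrix Bool Bool ℂ) :
    singleMatrix w V * singleMatrix w V' = singleMatrix w (V * V') := by
  refine ext_mulVec fun ψ p => ?_
  rw [← mulVec_mulVec, singleMatrix_mulVec, singleMatrix_mulVec]
  simp only [singleMatrix_mulVec, update_self, update_idem, Matrix.mul_apply, Fintype.sum_bool]
  ring

theorem singleMatrix_add (w : W) (V V' : Matrix Bool Bool ℂ) :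
    singleMatrix w (V + V') = singleMatrix w V + singleMatrix w V' := by
  ext p q; simp only [singleMatrix, of_apply, Matrix.add_apply]; split_ifs <;> simp

theorem singleMatrix_smul (w : W) (a : ℂ) (V : Matrix Bool Bool ℂ) :
    singleMatrix w (a • V) = a • singleMatrix w V := by
  ext p q; simp only [singleMatrix, of_apply, Matrix.smul_apply]; split_ifs <;> simp

theorem singleMatrix_one (w : W) : singleMatrix w 1 = 1 := by
  refine ext_mulVec fun ψ p => ?_
  rw [singleMatrix_mulVec, one_mulVec, Fintype.sum_bool]
  rcases h : p w <;> simp [← h]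

theorem conjTranspose_singleMatrix (w : W) (V : Matrix Bool Bool ℂ) :
    (singleMatrix w V)ᴴ = singleMatrix w Vᴴ := by
  ext p q
  have : q = update p w (q w) ↔ p = update q w (p w) := by
    constructor <;> intro h <;> (rw [h]; simp)
  simp only [singleMatrix, of_apply, conjTranspose_apply, this]
  split_ifs <;> simp

theorem mulVec_of_involutive {f : (W → Bool) → (W → Bool)} (hf : Involutive f)
    (ψ : (W → Bool) → ℂ) :
    (Matrix.of fun p q => if p = f q then (1 : ℂ) else 0) *ᵥ ψ = ψ ∘ f := by
  funext p
  have : ∀ q, p = f q ↔ q = f p := fun q => ⟨fun h => by rw [h, hf], fun h => by rw [h, hf]⟩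
  simp [mulVec, dotProduct, this]

theorem mem_unitaryGroup_of_involutive {f : (W → Bool) → (W → Bool)} (hf : Involutive f) :
    (Matrix.of fun p q => if p = f q then (1 : ℂ) else 0) ∈ Matrix.unitaryGroup (W → Bool) ℂ := by
  rw [mem_unitaryGroup_iff, star_eq_conjTranspose]
  have h1 : (Matrix.of fun p q => if p = f q then (1 : ℂ) else 0)ᴴ =
      Matrix.of fun p q => if p = f q then (1 : ℂ) else 0 := by
    ext p q
    have : q = f p ↔ p = f q := ⟨fun h => by rw [h, hf], fun h => by rw [h, hf]⟩
    simp only [of_apply, conjTranspose_apply, this]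
    split_ifs <;> simp
  rw [h1]
  refine ext_mulVec fun ψ p => ?_
  rw [← mulVec_mulVec, mulVec_of_involutive hf, mulVec_of_involutive hf, one_mulVec,
    Function.comp_apply, Function.comp_apply, hf]

/-- The operator of a list of gates; the head of the list is executed first. -/
def gatesMatrix : List (Gate W) → Matrix (W → Bool) (W → Bool) ℂ
  | [] => 1
  | g :: l => gatesMatrix l * g.toMatrix

theorem gatesMatrix_append (l l' : List (Gate W)) :
    gatesMatrix (l ++ l') = gatesMatrix l' * gatesMatrix l := by
  induction l with
  | nil => simp [gatesMatrix]
  | cons g l ih => simp [gatesMatrix, ih, Matrix.mul_assoc]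

theorem Gate.toMatrix_mem_unitaryGroup (g : Gate W) :
    g.toMatrix ∈ Matrix.unitaryGroup (W → Bool) ℂ := by
  cases g with
  | single w V =>
    change singleMatrix w V ∈ _
    rw [mem_unitaryGroup_iff, star_eq_conjTranspose, conjTranspose_singleMatrix, singleMatrix_mul,
      ← star_eq_conjTranspose, mem_unitaryGroup_iff.1 V.2, singleMatrix_one]
  | cnot c x h =>
    exact mem_unitaryGroup_of_involutive (f := flipIf x fun s => s c)
      (flipIf_involutive fun s b => by simp [h])
  | toffoli c d x hcd hc hd =>
    exact mem_unitaryGroup_of_involutive (f := flipIf x fun s => s c && s d)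
      (flipIf_involutive fun s b => by simp [hc, hd])

/-- The gates `l` implement the reversible map `f`, in the sense of composition with `f`. -/
def Implements (l : List (Gate W)) (f : (W → Bool) → (W → Bool)) : Prop :=
  ∀ ψ, gatesMatrix l *ᵥ ψ = ψ ∘ f

theorem implements_nil : Implements ([] : List (Gate W)) id := fun ψ => by
  simp [gatesMatrix]

/-- Composition with a map is contravariant, so the map of the gates executed first ends up
outermost. -/
theorem Implements.append {l l' : List (Gate W)} {f f' : (W → Bool) → (W → Bool)}
    (h : Implements l f) (h' : Implements l' f') : Implements (l ++ l') (f ∘ f') := fun ψ => by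
  rw [gatesMatrix_append, ← mulVec_mulVec, h, h', comp_assoc]

theorem implements_toffoli {c d x : W} (hcd : c ≠ d) (hc : c ≠ x) (hd : d ≠ x) :
    Implements [Gate.toffoli c d x hcd hc hd] (flipIf x fun s => s c && s d) := fun ψ => by
  rw [gatesMatrix, gatesMatrix, Matrix.one_mul]
  exact mulVec_of_involutive (flipIf_involutive fun s b => by simp [hc, hd]) ψ

/-- The Pauli matrix `X`. -/
def pauliX : Matrix Bool Bool ℂ := Matrix.of fun i j => if i = j then 0 else 1

theorem pauliX_mem : pauliX ∈ Matrix.unitaryGroup Bool ℂ := by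
  rw [mem_unitaryGroup_iff, star_eq_conjTranspose]
  ext i j
  rw [Matrix.mul_apply, Fintype.sum_bool]
  cases i <;> cases j <;> simp [pauliX]

theorem implements_not (w : W) :
    Implements [Gate.single w ⟨pauliX, pauliX_mem⟩] (flipIf w fun _ => true) := fun ψ => by
  rw [gatesMatrix, gatesMatrix, Matrix.one_mul]
  funext p
  refine (singleMatrix_mulVec w pauliX ψ p).trans ?_
  rw [Fintype.sum_bool, Function.comp_apply, flipIf]
  rcases h : p w <;> simp [pauliX]

/-- A palindromic ladder of Toffoli gates: it adds the conjunction of `xs` to `t`, and changes the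
borrowed qubits `ds` in an involutive way. -/
theorem exists_ladder : ∀ (xs ds : List W) (t : W), xs.length ≤ ds.length →
    (t :: (xs ++ ds)).Nodup →
    ∃ (l : List (Gate W)) (g : (W → Bool) → (W → Bool)), l.length = 2 * xs.length + 1 ∧
      Implements l g ∧ Involutive g ∧ (∀ s, g s t = xor (s t) (xs.all s)) ∧
      (∀ s w, w ∉ t :: ds → g s w = s w) ∧
      ∀ s w b, w ∉ t :: (xs ++ ds) → g (update s w b) = update (g s) w b := by
  intro xs
  induction xs with
  | nil =>
    intro ds t _ _
    refine ⟨_, _, rfl, implements_not t, flipIf_involutive fun _ _ => rfl, fun s => by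
      simp [flipIf], fun s w hw => ?_, fun s w b hw => ?_⟩
    · have : w ≠ t := fun h => hw (by simp [h])
      simp [flipIf, this]
    · have : w ≠ t := fun h => hw (by simp [h])
      simp [flipIf, this.symm, update_comm this]
  | cons x xs ih =>
    intro ds t hlen hnd
    obtain _ | ⟨d, ds⟩ := ds
    · simp at hlen
    have hxd : x ≠ d := by rintro rfl; simp at hnd
    have hxt : x ≠ t := by rintro rfl; simp at hnd
    have hdt : d ≠ t := by rintro rfl; simp at hnd
    have hnd' : (d :: (xs ++ ds)).Nodup := by
      simp only [List.cons_append, List.nodup_cons, List.nodup_append, List.mem_cons,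
        List.mem_append] at hnd ⊢
      grind
    have htn : t ∉ d :: (xs ++ ds) := by
      simp only [List.cons_append, List.nodup_cons, List.mem_cons, List.mem_append] at hnd ⊢
      grind
    have hxn : x ∉ d :: ds := by
      simp only [List.cons_append, List.nodup_cons, List.mem_cons, List.mem_append] at hnd ⊢
      grind
    obtain ⟨l, g, hl, himp, hinv, htgt, hfix, hupd⟩ := ih ds d (by simpa using hlen) hnd'
    set T : (W → Bool) → (W → Bool) := flipIf t fun s => s x && s d with hT
    have hTinv : Involutive T := flipIf_involutive fun s b => by simp [hxt, hdt]
    have hTimp : Implements _ T := implements_toffoli hxd hxt hdt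
    -- The two Toffolis add `x && d` to `t` before and after `d` has changed by the conjunction of
    -- `xs`; the difference is the conjunction of `x :: xs`. As a conjugate of an involution, the
    -- ladder is an involution.
    refine ⟨_, _, ?_, hTimp.append (himp.append hTimp), ?_, ?_, ?_, ?_⟩
    · simp [hl]; ring
    · intro s
      simp only [Function.comp_apply]
      rw [hTinv, hinv, hTinv]
    · intro s
      simp only [Function.comp_apply]
      rw [show T s = update s t (xor (s t) (s x && s d)) from rfl, hupd _ _ _ htn, hT]
      simp only [flipIf, update_self, update_of_ne hxt, update_of_ne hdt, hfix s x hxn, htgt,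
        List.all_cons]
      generalize s t = a; generalize s x = b; generalize s d = c; generalize xs.all s = e
      revert a b c e; decide
    · intro s w hw
      have hwt : w ≠ t := fun h => hw (by simp [h])
      have hw' : w ∉ d :: ds := fun h => hw (List.mem_cons_of_mem _ h)
      simp only [Function.comp_apply, hT]
      rw [flipIf, update_of_ne hwt, hfix _ _ hw', flipIf, update_of_ne hwt]
    · intro s w b hw
      have hwt : w ≠ t := fun h => hw (by simp [h])
      have hwx : w ≠ x := fun h => hw (by simp [h])
      have hwd : w ≠ d := fun h => hw (by simp [h])
      have hw' : w ∉ d :: (xs ++ ds) := fun h => hw (by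
        simp only [List.mem_cons, List.mem_append] at h ⊢; tauto)
      have hTu : ∀ s : W → Bool, T (update s w b) = update (T s) w b := fun s => by
        simp [hT, flipIf, hwt.symm, hwx.symm, hwd.symm, update_comm hwt]
      simp only [Function.comp_apply]
      rw [hTu, hupd _ _ _ hw', hTu]

/-- A multiply controlled NOT gate, with borrowed qubits `ds` that are restored. -/
theorem exists_multiControlledNot (xs ds : List W) (t : W) (hlen : xs.length ≤ ds.length)
    (hnd : (t :: (xs ++ ds)).Nodup) :
    ∃ l : List (Gate W), l.length ≤ 4 * xs.length + 1 ∧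
      Implements l (flipIf t fun s => xs.all s) := by
  obtain _ | ⟨x, xs⟩ := xs
  · exact ⟨_, by simp, implements_not t⟩
  obtain _ | ⟨d, ds⟩ := ds
  · simp at hlen
  have hxd : x ≠ d := by rintro rfl; simp at hnd
  have hxt : x ≠ t := by rintro rfl; simp at hnd
  have hdt : d ≠ t := by rintro rfl; simp at hnd
  have hnd' : (d :: (xs ++ ds)).Nodup := by
    simp only [List.cons_append, List.nodup_cons, List.nodup_append, List.mem_cons,
      List.mem_append] at hnd ⊢
    grind
  have htn : t ∉ d :: (xs ++ ds) := by
    simp only [List.cons_append, List.nodup_cons, List.mem_cons, List.mem_append] at hnd ⊢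
    grind
  have hxn : x ∉ d :: ds := by
    simp only [List.cons_append, List.nodup_cons, List.mem_cons, List.mem_append] at hnd ⊢
    grind
  obtain ⟨l, g, hl, himp, hinv, htgt, hfix, hupd⟩ :=
    exists_ladder xs ds d (by simpa using hlen) hnd'
  have hTimp := implements_toffoli hxd hxt hdt
  -- The second ladder undoes the first, so all borrowed qubits are restored, while the two Toffolis
  -- leave `x && xs.all s` on `t`.
  refine ⟨[Gate.toffoli x d t hxd hxt hdt] ++ (l ++ ([Gate.toffoli x d t hxd hxt hdt] ++ l)),
    ?_, ?_⟩
  · simp [hl]; omega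
  convert hTimp.append (himp.append (hTimp.append himp)) using 1
  funext s
  simp only [Function.comp_apply]
  rw [show flipIf t (fun s => s x && s d) (g s) =
    update (g s) t (xor (g s t) (g s x && g s d)) from rfl, hupd _ _ _ htn, hinv]
  simp only [flipIf, update_self, update_of_ne hxt, update_of_ne hdt, update_idem, htgt,
    hfix s x hxn, hfix s t (fun h => htn (by
      simp only [List.mem_cons, List.mem_append] at h ⊢; tauto)), List.all_cons]
  congr 1
  generalize s t = a; generalize s x = b; generalize s d = c; generalize xs.all s = e
  revert a b c e; decide

/-- Barenco et al.: a multiply controlled NOT gate with linearly many Toffoli gates, where two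
borrowed qubits suffice. -/
theorem exists_multiControlledNot_two_borrowed (xs : List W) (t b e : W)
    (hnd : (t :: b :: e :: xs).Nodup) :
    ∃ l : List (Gate W), l.length ≤ 8 * xs.length + 12 ∧
      Implements l (flipIf t fun s => xs.all s) := by
  -- The controls are halved so that each half, with `e`, provides enough borrowed qubits for the
  -- gate controlled by the other half.
  obtain ⟨A, B, rfl, hlA, hlB⟩ : ∃ A B : List W, xs = A ++ B ∧ A.length ≤ B.length + 1 ∧
      B.length ≤ A.length :=
    ⟨xs.take ((xs.length + 1) / 2), xs.drop ((xs.length + 1) / 2),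
      (List.take_append_drop _ xs).symm, by rw [List.length_take, List.length_drop]; omega,
      by rw [List.length_take, List.length_drop]; omega⟩
  simp only [List.nodup_cons, List.nodup_append, List.mem_cons, List.mem_append] at hnd
  have hbt : b ≠ t := by grind
  have hAt : ∀ w ∈ A, w ≠ t := by grind
  have hBt : ∀ w ∈ B, w ≠ t := by grind
  have hAb : ∀ w ∈ A, w ≠ b := by grind
  have hBb : ∀ w ∈ B, w ≠ b := by grind
  obtain ⟨l₁, hl₁, h₁⟩ := exists_multiControlledNot A (B ++ [e]) b
    (by simp only [List.length_append, List.length_singleton]; omega) (by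
      simp only [List.nodup_cons, List.nodup_append, List.mem_cons, List.mem_append,
        List.nodup_nil, List.not_mem_nil]
      grind)
  obtain ⟨l₂, hl₂, h₂⟩ := exists_multiControlledNot (b :: B) (A ++ [e]) t
    (by simp only [List.length_append, List.length_cons]; omega) (by
      simp only [List.nodup_cons, List.nodup_append, List.mem_cons, List.mem_append,
        List.nodup_nil, List.not_mem_nil, List.cons_append]
      grind)
  -- A commutator: `b` is toggled twice by `A` and so restored, while `t` receives `b && B` for both
  -- values of `b`, whose sum is `A && B`.
  refine ⟨l₁ ++ (l₂ ++ (l₁ ++ l₂)), ?_, ?_⟩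
  · simp only [List.length_append, List.length_cons] at hl₁ hl₂ ⊢
    omega
  convert h₁.append (h₂.append (h₁.append h₂)) using 1
  have hall : ∀ (L : List W) (s : W → Bool) (w : W) (v : Bool), (∀ y ∈ L, y ≠ w) →
      L.all (update s w v) = L.all s := fun L s w v h => by
    rw [Bool.eq_iff_iff, List.all_eq_true, List.all_eq_true]
    exact forall₂_congr fun y hy => by rw [update_of_ne (h y hy)]
  funext s
  simp only [Function.comp_apply, flipIf, List.all_append, List.all_cons, update_self, hall A _ t _ hAt,
    hall A _ b _ hAb, hall B _ t _ hBt, hall B _ b _ hBb, update_of_ne hbt, update_of_ne hbt.symm]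
  generalize A.all s = x
  generalize B.all s = y
  funext w
  rcases eq_or_ne w t with rfl | hwt
  · simp only [update_self, update_of_ne hbt.symm]
    generalize s w = a; generalize s b = c
    revert a c x y; decide
  rcases eq_or_ne w b with rfl | hwb
  · simp only [update_self, update_of_ne hbt]
    generalize s w = a
    revert a x y; decide
  simp [hwt, hwb]

theorem exists_not_all (xs : List W) (hnd : xs.Nodup) : ∃ l : List (Gate W),
    l.length = xs.length ∧ Implements l (fun s w => xor (s w) (decide (w ∈ xs))) := by
  induction xs with
  | nil => exact ⟨[], rfl, by convert implements_nil (W := W) using 1; funext s w; simp⟩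
  | cons x xs ih =>
    obtain ⟨hx, hnd⟩ := List.nodup_cons.1 hnd
    obtain ⟨l, hl, h⟩ := ih hnd
    refine ⟨[Gate.single x ⟨pauliX, pauliX_mem⟩] ++ l, ?_, ?_⟩
    · simp [hl]
    convert (implements_not x).append h using 1
    funext s w
    rcases eq_or_ne w x with rfl | hw
    · simp [flipIf, hx]
    · simp [flipIf, hw]

theorem exists_multiControlledNot_zero (xs : List W) (t b e : W)
    (hnd : (t :: b :: e :: xs).Nodup) :
    ∃ l : List (Gate W), l.length ≤ 10 * xs.length + 12 ∧
      Implements l (flipIf t fun s => xs.all fun w => !s w) := by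
  have ht : t ∉ xs := by
    simp only [List.nodup_cons, List.mem_cons] at hnd; tauto
  obtain ⟨l₁, hl₁, h₁⟩ := exists_not_all xs (by
    simp only [List.nodup_cons] at hnd; tauto)
  obtain ⟨l₂, hl₂, h₂⟩ := exists_multiControlledNot_two_borrowed xs t b e hnd
  refine ⟨l₁ ++ (l₂ ++ l₁), by simp only [List.length_append]; omega, ?_⟩
  convert h₁.append (h₂.append h₁) using 1
  funext s w
  have h : (xs.all fun w => xor (s w) (decide (w ∈ xs))) = xs.all fun w => !s w := by
    rw [Bool.eq_iff_iff, List.all_eq_true, List.all_eq_true]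
    exact forall₂_congr fun y hy => by simp [hy]
  simp only [Function.comp_apply, flipIf]
  rcases eq_or_ne w t with rfl | hw
  · simp [ht, h]
  · simp [hw]

/-- The Hadamard matrix. -/
noncomputable def hadamard : Matrix Bool Bool ℂ :=
  (((√2)⁻¹ : ℝ) : ℂ) • Matrix.of fun i j => if i && j then -1 else 1

theorem hadamard_mul_self : hadamard * hadamard = 1 := by
  have h : (((√2)⁻¹ : ℝ) : ℂ) * (((√2)⁻¹ : ℝ) : ℂ) = 1 / 2 := by
    rw [← Complex.ofReal_mul, ← mul_inv, Real.mul_self_sqrt (by norm_num)]; norm_num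
  rw [hadamard, smul_mul_smul_comm, h]
  ext i j
  rw [Matrix.smul_apply, Matrix.mul_apply, Fintype.sum_bool]
  cases i <;> cases j <;> simp <;> norm_num

theorem hadamard_mem : hadamard ∈ Matrix.unitaryGroup Bool ℂ := by
  have h : hadamardᴴ = hadamard := by
    ext i j
    cases i <;> cases j <;> simp [hadamard]
  rw [mem_unitaryGroup_iff, star_eq_conjTranspose, h, hadamard_mul_self]

/-- Since `H X H = Z`, this is `X Z X = -Z`, which puts the sign on the state `0`. -/
theorem hadamard_mul_pauliX_mul_hadamard :
    pauliX * hadamard * pauliX * (hadamard * pauliX) =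
      Matrix.of fun i j => if i = j then (if i then 1 else -1) else 0 := by
  have h : (((√2)⁻¹ : ℝ) : ℂ) * (((√2)⁻¹ : ℝ) : ℂ) = 1 / 2 := by
    rw [← Complex.ofReal_mul, ← mul_inv, Real.mul_self_sqrt (by norm_num)]; norm_num
  ext i j
  simp only [Matrix.mul_apply, Fintype.sum_bool, hadamard, pauliX, Matrix.smul_apply, of_apply,
    smul_eq_mul]
  generalize (((√2)⁻¹ : ℝ) : ℂ) = r at *
  cases i <;> cases j <;> simp <;>
    first | linear_combination (-2 : ℂ) * h | linear_combination (2 : ℂ) * h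

/-- The sign flip of the states in which the qubit `t` and the qubits `xs` are all `0`. -/
theorem exists_reflection (xs : List W) (t b e : W) (hnd : (t :: b :: e :: xs).Nodup) :
    ∃ l : List (Gate W), l.length ≤ 10 * xs.length + 14 ∧ gatesMatrix l =
      Matrix.diagonal fun s => if s t = false ∧ ∀ w ∈ xs, s w = false then (-1 : ℂ) else 1 := by
  have ht : t ∉ xs := by
    simp only [List.nodup_cons, List.mem_cons] at hnd; tauto
  obtain ⟨l, hl, h⟩ := exists_multiControlledNot_zero xs t b e hnd
  have hV₁ : hadamard * pauliX ∈ Matrix.unitaryGroup Bool ℂ := mul_mem hadamard_mem pauliX_mem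
  have hV₂ : pauliX * hadamard ∈ Matrix.unitaryGroup Bool ℂ := mul_mem pauliX_mem hadamard_mem
  -- Conjugation turns the controlled NOT on `t` into a controlled `-Z`. When the controls fail, the
  -- two one-qubit gates cancel.
  refine ⟨Gate.single t ⟨_, hV₁⟩ :: (l ++ [Gate.single t ⟨_, hV₂⟩]), ?_, ?_⟩
  · simp only [List.length_cons, List.length_append, List.length_nil]; omega
  rw [gatesMatrix, gatesMatrix_append, gatesMatrix, gatesMatrix, Matrix.one_mul]
  change singleMatrix t (pauliX * hadamard) * gatesMatrix l * singleMatrix t (hadamard * pauliX) = _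
  refine ext_mulVec fun ψ p => ?_
  rw [← mulVec_mulVec, ← mulVec_mulVec, h, singleMatrix_mulVec, mulVec_diagonal]
  have hall : ∀ v, (xs.all fun w => !(update p t v) w) = xs.all fun w => !p w := fun v => by
    rw [Bool.eq_iff_iff, List.all_eq_true, List.all_eq_true]
    exact forall₂_congr fun y hy => by
      rw [update_of_ne (fun h => ht (h ▸ hy) : y ≠ t)]
  simp only [Function.comp_apply, singleMatrix_mulVec, flipIf, update_self, update_idem, hall]
  by_cases hx : ∀ w ∈ xs, p w = false
  · have hx' : (xs.all fun w => !p w) = true := by simpa using hx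
    have key : ∀ j, ∑ v, (pauliX * hadamard) (p t) v * (hadamard * pauliX) (!v) j =
        if p t = j then (if p t then 1 else -1) else 0 := fun j => by
      have := congrFun (congrFun hadamard_mul_pauliX_mul_hadamard (p t)) j
      rw [of_apply] at this
      rw [← this, Matrix.mul_apply]
      refine Finset.sum_equiv Equiv.boolNot (by simp) fun v _ => ?_
      rw [Matrix.mul_apply (M := pauliX * hadamard)]
      congr 1
      simp only [Fintype.sum_bool, pauliX, of_apply]
      cases v <;> simp
    have hT := key true
    have hF := key false
    simp only [Fintype.sum_bool, hx', Bool.xor_true] at hT hF ⊢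
    have hpsi : ψ p = ψ (update p t (p t)) := by rw [update_eq_self]
    rw [hpsi]
    generalize hq : p t = q at *
    simp only [eq_true hx, and_true]
    cases q <;> simp at hT hF ⊢ <;>
      linear_combination ψ (update p t true) * hT + ψ (update p t false) * hF
  · have hx' : (xs.all fun w => !p w) = false := by
      rw [Bool.eq_false_iff]; simpa using hx
    have hone : pauliX * hadamard * (hadamard * pauliX) = 1 := by
      rw [Matrix.mul_assoc, ← Matrix.mul_assoc hadamard, hadamard_mul_self, Matrix.one_mul]
      ext i j
      rw [Matrix.mul_apply, Fintype.sum_bool]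
      cases i <;> cases j <;> simp [pauliX]
    have h3 := congrFun (congrArg (fun M => M *ᵥ ψ)
      ((singleMatrix_mul t (pauliX * hadamard) (hadamard * pauliX)).trans
        ((congrArg _ hone).trans (singleMatrix_one t)))) p
    simp only [← mulVec_mulVec, one_mulVec, singleMatrix_mulVec, update_self, update_idem] at h3
    simp only [hx', Bool.xor_false, hx, and_false, if_false, one_mul]
    exact h3

end Gates

/-! ### Query circuits: controlled walk operators and signal processing of them. -/

section Circuits

open Function Matrix Polynomial

variable {ι : Type} {m a : ℕ}

theorem extend_eq_submatrix (U : Matrix (ι × (Fin m → Bool)) (ι × (Fin m → Bool)) ℂ) :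
    extend a U = (kronecker U (1 : Matrix (Fin a → Bool) (Fin a → Bool) ℂ)).submatrix
      (((Equiv.refl ι).prodCongr (Equiv.sumArrowEquivProdArrow _ _ _)).trans
        (Equiv.prodAssoc _ _ _).symm)
      (((Equiv.refl ι).prodCongr (Equiv.sumArrowEquivProdArrow _ _ _)).trans
        (Equiv.prodAssoc _ _ _).symm) := by
  ext p q
  change (if p.2 ∘ Sum.inr = q.2 ∘ Sum.inr then _ else _) =
    U _ _ * (1 : Matrix (Fin a → Bool) (Fin a → Bool) ℂ) (p.2 ∘ Sum.inr) (q.2 ∘ Sum.inr)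
  rw [Matrix.one_apply]
  split_ifs
  · exact (mul_one _).symm
  · exact (mul_zero _).symm

theorem extend_add (U V : Matrix (ι × (Fin m → Bool)) (ι × (Fin m → Bool)) ℂ) :
    extend a (U + V) = extend a U + extend a V := by
  ext p q; simp only [extend, of_apply, Matrix.add_apply]; split_ifs <;> simp

theorem extend_smul (r : ℂ) (U : Matrix (ι × (Fin m → Bool)) (ι × (Fin m → Bool)) ℂ) :
    extend a (r • U) = r • extend a U := by
  ext p q; simp only [extend, of_apply, Matrix.smul_apply]; split_ifs <;> simp

theorem conjTranspose_extend (U : Matrix (ι × (Fin m → Bool)) (ι × (Fin m → Bool)) ℂ) :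
    (extend a U)ᴴ = extend a Uᴴ := by
  ext p q
  simp only [extend, of_apply, conjTranspose_apply, eq_comm (a := p.2 ∘ Sum.inr)]
  split_ifs <;> simp

theorem extend_one [DecidableEq ι] : extend a (1 : Matrix (ι × (Fin m → Bool)) (ι × (Fin m → Bool)) ℂ) = 1 := by
  rw [extend_eq_submatrix, kronecker, one_kronecker_one, submatrix_one_equiv]

theorem kronecker_diagonal_apply [DecidableEq ι] {W : Type} [Fintype W] [DecidableEq W] (f : (W → Bool) → ℂ) :
    kronecker (1 : Matrix ι ι ℂ) (diagonal f) = diagonal fun x => f x.2 := by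
  rw [← diagonal_one, kronecker, diagonal_kronecker_diagonal]
  simp

variable [Fintype ι]

theorem extend_mul (U V : Matrix (ι × (Fin m → Bool)) (ι × (Fin m → Bool)) ℂ) :
    extend a (U * V) = extend a U * extend a V := by
  rw [extend_eq_submatrix, extend_eq_submatrix, extend_eq_submatrix, submatrix_mul_equiv,
    kronecker, ← mul_kronecker_mul, Matrix.one_mul]

theorem extend_mulVec (U : Matrix (ι × (Fin m → Bool)) (ι × (Fin m → Bool)) ℂ)
    (ψ : ι × (Fin m ⊕ Fin a → Bool) → ℂ) (x : ι × (Fin m ⊕ Fin a → Bool)) :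
    (extend a U *ᵥ ψ) x = ∑ y, U (x.1, x.2 ∘ Sum.inl) y *
      ψ (y.1, Sum.elim y.2 (x.2 ∘ Sum.inr)) := by
  rw [mulVec, dotProduct, ← (((Equiv.refl ι).prodCongr
    (Equiv.sumArrowEquivProdArrow _ _ _)).trans (Equiv.prodAssoc _ _ _).symm).symm.sum_comp,
    Fintype.sum_prod_type]
  refine Finset.sum_congr rfl fun y _ => ?_
  rw [Finset.sum_eq_single (x.2 ∘ Sum.inr)]
  · change (if x.2 ∘ Sum.inr = (Sum.elim y.2 (x.2 ∘ Sum.inr)) ∘ Sum.inr then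
      U (x.1, x.2 ∘ Sum.inl) (y.1, (Sum.elim y.2 (x.2 ∘ Sum.inr)) ∘ Sum.inl) else 0) *
      ψ (y.1, Sum.elim y.2 (x.2 ∘ Sum.inr)) = _
    rw [Sum.elim_comp_inr, Sum.elim_comp_inl, if_pos rfl]
  · intro f _ hf
    change (if x.2 ∘ Sum.inr = (Sum.elim y.2 f) ∘ Sum.inr then _ else 0) * _ = (0 : ℂ)
    rw [Sum.elim_comp_inr, if_neg (Ne.symm hf), zero_mul]
  · simp

variable [DecidableEq ι]

theorem kronecker_one_mulVec {W : Type} [Fintype W] (g : Matrix (W → Bool) (W → Bool) ℂ)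
    [DecidableEq W] (ψ : ι × (W → Bool) → ℂ) (x : ι × (W → Bool)) :
    (kronecker (1 : Matrix ι ι ℂ) g *ᵥ ψ) x = (g *ᵥ fun q => ψ (x.1, q)) x.2 := by
  rw [mulVec, dotProduct, Fintype.sum_prod_type, Finset.sum_eq_single x.1]
  · simp [mulVec, dotProduct, kronecker, kroneckerMap_apply]
  · intro i _ hi
    simp [kronecker, kroneckerMap_apply, Matrix.one_apply_ne (Ne.symm hi)]
  · simp

/-- The operator `U` on system and flags, tensored with `V` on the ancilla qubit `c`. -/
def controlTensor (c : Fin a) (U : Matrix (ι × (Fin m → Bool)) (ι × (Fin m → Bool)) ℂ)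
    (V : Matrix Bool Bool ℂ) :
    Matrix (ι × (Fin m ⊕ Fin a → Bool)) (ι × (Fin m ⊕ Fin a → Bool)) ℂ :=
  extend a U * kronecker (1 : Matrix ι ι ℂ) (singleMatrix (Sum.inr c) V)

theorem kronecker_singleMatrix_mul_extend (c : Fin a)
    (U : Matrix (ι × (Fin m → Bool)) (ι × (Fin m → Bool)) ℂ) (V : Matrix Bool Bool ℂ) :
    kronecker (1 : Matrix ι ι ℂ) (singleMatrix (Sum.inr c) V) * extend a U =
      extend a U * kronecker (1 : Matrix ι ι ℂ) (singleMatrix (Sum.inr c) V) := by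
  refine ext_mulVec fun ψ x => ?_
  rw [← mulVec_mulVec, ← mulVec_mulVec, kronecker_one_mulVec, singleMatrix_mulVec, extend_mulVec]
  simp only [extend_mulVec, kronecker_one_mulVec, singleMatrix_mulVec, Finset.mul_sum]
  rw [Finset.sum_comm]
  refine Finset.sum_congr rfl fun y _ => Finset.sum_congr rfl fun b _ => ?_
  have h1 : update x.2 (Sum.inr c) b ∘ Sum.inl = x.2 ∘ Sum.inl := by
    funext i; simp
  have h2 : Sum.elim y.2 (update x.2 (Sum.inr c) b ∘ Sum.inr) =
      update (Sum.elim y.2 (x.2 ∘ Sum.inr)) (Sum.inr c) b := by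
    funext i
    rcases i with i | i
    · simp
    · rcases eq_or_ne i c with rfl | hi
      · simp
      · simp [hi]
  rw [h1, h2, Sum.elim_inr, Function.comp_apply]
  ring

theorem controlTensor_mul (c : Fin a) (U U' : Matrix (ι × (Fin m → Bool)) (ι × (Fin m → Bool)) ℂ)
    (V V' : Matrix Bool Bool ℂ) :
    controlTensor c U V * controlTensor c U' V' = controlTensor c (U * U') (V * V') := by
  rw [controlTensor, controlTensor, Matrix.mul_assoc, ← Matrix.mul_assoc (kronecker _ _),
    kronecker_singleMatrix_mul_extend, Matrix.mul_assoc, ← Matrix.mul_assoc (extend a U),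
    ← extend_mul, kronecker, ← mul_kronecker_mul, singleMatrix_mul, Matrix.one_mul]
  rfl

theorem controlTensor_add_left (c : Fin a)
    (U U' : Matrix (ι × (Fin m → Bool)) (ι × (Fin m → Bool)) ℂ) (V : Matrix Bool Bool ℂ) :
    controlTensor c (U + U') V = controlTensor c U V + controlTensor c U' V := by
  simp only [controlTensor, extend_add, Matrix.add_mul]

theorem controlTensor_add_right (c : Fin a)
    (U : Matrix (ι × (Fin m → Bool)) (ι × (Fin m → Bool)) ℂ) (V V' : Matrix Bool Bool ℂ) :
    controlTensor c U (V + V') = controlTensor c U V + controlTensor c U V' := by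
  simp only [controlTensor, singleMatrix_add, kronecker, kronecker_add, Matrix.mul_add]

theorem controlTensor_smul_left (c : Fin a) (r : ℂ)
    (U : Matrix (ι × (Fin m → Bool)) (ι × (Fin m → Bool)) ℂ) (V : Matrix Bool Bool ℂ) :
    controlTensor c (r • U) V = r • controlTensor c U V := by
  simp only [controlTensor, extend_smul, Matrix.smul_mul]

theorem controlTensor_smul_right (c : Fin a) (r : ℂ)
    (U : Matrix (ι × (Fin m → Bool)) (ι × (Fin m → Bool)) ℂ) (V : Matrix Bool Bool ℂ) :
    controlTensor c U (r • V) = r • controlTensor c U V := by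
  simp only [controlTensor, singleMatrix_smul, kronecker, kronecker_smul, Matrix.mul_smul]

theorem controlTensor_zero_right (c : Fin a)
    (U : Matrix (ι × (Fin m → Bool)) (ι × (Fin m → Bool)) ℂ) :
    controlTensor c U 0 = 0 := by
  have := controlTensor_smul_right c 0 U 0
  simpa using this

theorem controlTensor_one_right (c : Fin a)
    (U : Matrix (ι × (Fin m → Bool)) (ι × (Fin m → Bool)) ℂ) :
    controlTensor c U 1 = extend a U := by
  rw [controlTensor, singleMatrix_one, kronecker, one_kronecker_one, Matrix.mul_one]

theorem controlTensor_one_left (c : Fin a) (V : Matrix Bool Bool ℂ) :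
    controlTensor c (1 : Matrix (ι × (Fin m → Bool)) (ι × (Fin m → Bool)) ℂ) V =
      kronecker (1 : Matrix ι ι ℂ) (singleMatrix (Sum.inr c) V) := by
  rw [controlTensor, extend_one, Matrix.one_mul]

/-- The matrix unit of `ℂ^{2 × 2}`. -/
abbrev unit₂ (i j : Bool) : Matrix Bool Bool ℂ := Matrix.single i j 1

theorem unit₂_add : unit₂ true true + unit₂ false false = 1 := by
  ext i j; cases i <;> cases j <;> simp [unit₂, Matrix.single]

theorem mul_unit₂ (V : Matrix Bool Bool ℂ) (i j : Bool) :
    V * unit₂ i j = V false i • unit₂ false j + V true i • unit₂ true j := by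
  ext k l
  rw [Matrix.mul_apply, Fintype.sum_bool]
  cases i <;> cases j <;> cases k <;> cases l <;> simp [unit₂, Matrix.single]

theorem singleMatrix_unit₂_false {W : Type} [Fintype W] [DecidableEq W] (w : W) :
    singleMatrix w (unit₂ false false) =
      diagonal fun s => if s w = false then (1 : ℂ) else 0 := by
  refine ext_mulVec fun ψ p => ?_
  rw [singleMatrix_mulVec, mulVec_diagonal, Fintype.sum_bool]
  have : ψ p = ψ (update p w (p w)) := by rw [update_eq_self]
  rw [this]
  cases p w <;> simp [unit₂, Matrix.single]

/-- Projecting the ancilla onto `0` on both sides does not affect the encoded block, so a circuit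
need only be known on that subspace. -/
theorem mul_unit_apply_zero (c : Fin a)
    (M : Matrix (ι × (Fin m ⊕ Fin a → Bool)) (ι × (Fin m ⊕ Fin a → Bool)) ℂ) (i j : ι) :
    (controlTensor c 1 (unit₂ false false) * (M * controlTensor c 1 (unit₂ false false)) :
        Matrix (ι × (Fin m ⊕ Fin a → Bool)) (ι × (Fin m ⊕ Fin a → Bool)) ℂ) (i, fun _ => false) (j, fun _ => false) = M (i, fun _ => false) (j, fun _ => false) := by
  rw [controlTensor_one_left, singleMatrix_unit₂_false, kronecker_diagonal_apply,
    diagonal_mul, mul_diagonal]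
  simp

theorem controlTensor_apply_zero (c : Fin a)
    (U : Matrix (ι × (Fin m → Bool)) (ι × (Fin m → Bool)) ℂ) (i j : ι) :
    controlTensor c U (unit₂ false false) (i, fun _ => false) (j, fun _ => false) =
      U (i, fun _ => false) (j, fun _ => false) := by
  rw [controlTensor, singleMatrix_unit₂_false, kronecker_diagonal_apply, mul_diagonal]
  simp [extend]

/-- The reflection `1 - 2 |0⟩⟨0|` on the flags. -/
def flagReflection (ι : Type) [DecidableEq ι] (m : ℕ) :
    Matrix (ι × (Fin m → Bool)) (ι × (Fin m → Bool)) ℂ :=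
  diagonal fun x => if x.2 = fun _ => false then -1 else 1

theorem extend_diagonal (f : ι × (Fin m → Bool) → ℂ) :
    extend a (diagonal f) = diagonal fun x => f (x.1, x.2 ∘ Sum.inl) := by
  refine ext_mulVec fun ψ x => ?_
  rw [extend_mulVec, mulVec_diagonal, Finset.sum_eq_single (x.1, x.2 ∘ Sum.inl)]
  · rw [diagonal_apply_eq, Sum.elim_comp_inl_inr]
  · intro y _ hy
    rw [diagonal_apply_ne _ (Ne.symm hy), zero_mul]
  · simp

theorem circuit_eval_append (U : Matrix (ι × (Fin m → Bool)) (ι × (Fin m → Bool)) ℂ)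
    (c c' : Circuit m a) :
    Circuit.eval U (c ++ c') = Circuit.eval U c' * Circuit.eval U c := by
  induction c with
  | nil => exact (Matrix.mul_one _).symm
  | cons s c ih =>
    change Circuit.eval U (c ++ c') * _ = _ * (Circuit.eval U c * _)
    rw [ih, Matrix.mul_assoc]

theorem circuit_eval_map_gate (U : Matrix (ι × (Fin m → Bool)) (ι × (Fin m → Bool)) ℂ)
    (l : List (Gate (Fin m ⊕ Fin a))) :
    Circuit.eval U (l.map Step.gate) = kronecker (1 : Matrix ι ι ℂ) (gatesMatrix l) := by
  induction l with
  | nil => exact (one_kronecker_one).symm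
  | cons g l ih =>
    change Circuit.eval U (l.map Step.gate) * kronecker 1 g.toMatrix = _
    rw [ih, kronecker, ← mul_kronecker_mul, Matrix.one_mul]
    rfl

theorem circuit_eval_mem (U : Matrix (ι × (Fin m → Bool)) (ι × (Fin m → Bool)) ℂ)
    (hU : U ∈ unitaryGroup (ι × (Fin m → Bool)) ℂ) (c : Circuit m a) :
    Circuit.eval U c ∈ unitaryGroup (ι × (Fin m ⊕ Fin a → Bool)) ℂ := by
  induction c with
  | nil => exact one_mem _
  | cons s c ih =>
    refine mul_mem ih ?_
    cases s with
    | query =>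
      change extend a U ∈ _
      rw [mem_unitaryGroup_iff, star_eq_conjTranspose, conjTranspose_extend, ← extend_mul,
        ← star_eq_conjTranspose, mem_unitaryGroup_iff.1 hU, extend_one]
    | queryInv =>
      change extend a Uᴴ ∈ _
      rw [mem_unitaryGroup_iff, star_eq_conjTranspose, conjTranspose_extend, ← extend_mul,
        conjTranspose_conjTranspose, ← star_eq_conjTranspose, mem_unitaryGroup_iff'.1 hU,
        extend_one]
    | gate g =>
      change kronecker 1 g.toMatrix ∈ _
      exact kronecker_mem_unitary (one_mem _) g.toMatrix_mem_unitaryGroup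

theorem queries_append (c c' : Circuit m a) :
    Circuit.queries (c ++ c') = Circuit.queries c + Circuit.queries c' := by
  induction c with
  | nil => exact (zero_add _).symm
  | cons s c ih =>
    cases s <;> simp only [List.cons_append, Circuit.queries, ih] <;> ring

theorem gates_append (c c' : Circuit m a) :
    Circuit.gates (c ++ c') = Circuit.gates c + Circuit.gates c' := by
  induction c with
  | nil => exact (zero_add _).symm
  | cons s c ih =>
    cases s <;> simp only [List.cons_append, Circuit.gates, ih]
    ring

theorem queries_map_gate (l : List (Gate (Fin m ⊕ Fin a))) :
    Circuit.queries (l.map Step.gate : Circuit m a) = 0 := by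
  induction l with
  | nil => rfl
  | cons g l ih => exact ih

theorem gates_map_gate (l : List (Gate (Fin m ⊕ Fin a))) :
    Circuit.gates (l.map Step.gate : Circuit m a) = l.length := by
  induction l with
  | nil => rfl
  | cons g l ih => exact congrArg (· + 1) ih

/-- Ancilla 0 is an extra zero condition of the sign flip, hence a control that is active on `0`.
Ancillas 1 and 2 are the borrowed qubits. -/
theorem exists_controlled_reflection (m : ℕ) : ∃ l : List (Gate (Fin m ⊕ Fin 3)),
    l.length ≤ 10 * m + 14 ∧ ∀ (ι : Type) [Fintype ι] [DecidableEq ι],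
      kronecker (1 : Matrix ι ι ℂ) (gatesMatrix l) =
        controlTensor 0 1 (unit₂ true true) +
          controlTensor 0 (flagReflection ι m) (unit₂ false false) := by
  obtain ⟨l, hl, h⟩ := exists_reflection ((List.finRange m).map (Sum.inl : Fin m → Fin m ⊕ Fin 3))
    (Sum.inr 0) (Sum.inr 1) (Sum.inr 2) (by
      simp [List.nodup_finRange m |>.map Sum.inl_injective])
  refine ⟨l, by simpa using hl, fun ι _ _ => ?_⟩
  have h1 : controlTensor (0 : Fin 3) (1 : Matrix (ι × (Fin m → Bool)) (ι × (Fin m → Bool)) ℂ)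
      (unit₂ true true) = 1 - controlTensor 0 1 (unit₂ false false) := by
    rw [eq_sub_iff_add_eq, ← controlTensor_add_right, unit₂_add, controlTensor_one_right,
      extend_one]
  rw [h1, h, controlTensor_one_left, controlTensor, flagReflection, extend_diagonal,
    singleMatrix_unit₂_false, kronecker_diagonal_apply, kronecker_diagonal_apply,
    diagonal_mul_diagonal, ← diagonal_one, diagonal_sub, diagonal_add]
  congr 1
  funext x
  have hx : (x.2 ∘ Sum.inl = fun _ => false) ↔ ∀ i, x.2 (Sum.inl i) = false := funext_iff
  simp only [List.mem_map, List.mem_finRange, true_and, forall_exists_index,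
    forall_apply_eq_imp_iff, hx]
  by_cases h2 : x.2 (Sum.inr 0) = false <;> by_cases h3 : ∀ i, x.2 (Sum.inl i) = false <;>
    simp [h2, h3]

/-- The walk operator of a block encoding. -/
def walk (U : Matrix (ι × (Fin m → Bool)) (ι × (Fin m → Bool)) ℂ) :
    Matrix (ι × (Fin m → Bool)) (ι × (Fin m → Bool)) ℂ :=
  flagReflection ι m * Uᴴ * flagReflection ι m * U

/-- The inverse of the walk operator of a block encoding. -/
def walkInv (U : Matrix (ι × (Fin m → Bool)) (ι × (Fin m → Bool)) ℂ) :
    Matrix (ι × (Fin m → Bool)) (ι × (Fin m → Bool)) ℂ :=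
  Uᴴ * flagReflection ι m * U * flagReflection ι m

theorem controlled_mul_extend_mul (c : Fin a)
    (A A' B B' : Matrix (ι × (Fin m → Bool)) (ι × (Fin m → Bool)) ℂ) :
    (controlTensor c A' (unit₂ true true) + controlTensor c B' (unit₂ false false)) *
        (controlTensor c A (unit₂ true true) + controlTensor c B (unit₂ false false)) =
      controlTensor c (A' * A) (unit₂ true true) +
        controlTensor c (B' * B) (unit₂ false false) := by
  simp only [Matrix.add_mul, Matrix.mul_add, controlTensor_mul]
  simp [unit₂, controlTensor_zero_right]

theorem extend_eq_controlTensor (c : Fin a)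
    (U : Matrix (ι × (Fin m → Bool)) (ι × (Fin m → Bool)) ℂ) :
    extend a U = controlTensor c U (unit₂ true true) + controlTensor c U (unit₂ false false) := by
  rw [← controlTensor_add_right, unit₂_add, controlTensor_one_right]

/-- Only the reflections are controlled. The queries are not: in the idle branch `U` and `U†` meet
and cancel. -/
theorem exists_controlled_walk (m : ℕ) : ∃ c c' : Circuit m 3,
    (Circuit.queries c = 2 ∧ Circuit.gates c ≤ 2 * (10 * m + 14)) ∧
    (Circuit.queries c' = 2 ∧ Circuit.gates c' ≤ 2 * (10 * m + 14)) ∧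
    ∀ (ι : Type) [Fintype ι] [DecidableEq ι]
      (U : Matrix (ι × (Fin m → Bool)) (ι × (Fin m → Bool)) ℂ),
      U ∈ unitaryGroup (ι × (Fin m → Bool)) ℂ →
      Circuit.eval U c = controlTensor 0 1 (unit₂ true true) +
        controlTensor 0 (walk U) (unit₂ false false) ∧
      Circuit.eval U c' = controlTensor 0 1 (unit₂ true true) +
        controlTensor 0 (walkInv U) (unit₂ false false) := by
  obtain ⟨l, hl, h⟩ := exists_controlled_reflection m
  refine ⟨[.query] ++ (l.map Step.gate ++ ([.queryInv] ++ l.map Step.gate)),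
    l.map Step.gate ++ ([.query] ++ (l.map Step.gate ++ [.queryInv])), ⟨?_, ?_⟩, ⟨?_, ?_⟩, ?_⟩
  · simp only [queries_append, queries_map_gate, Circuit.queries]
  · simp only [gates_append, gates_map_gate, Circuit.gates]; omega
  · simp only [queries_append, queries_map_gate, Circuit.queries]
  · simp only [gates_append, gates_map_gate, Circuit.gates]; omega
  intro ι _ _ U hU
  have hU' : Uᴴ * U = 1 := mem_unitaryGroup_iff'.1 hU
  have hq : Circuit.eval U [.query] = controlTensor (0 : Fin 3) U (unit₂ true true) +
      controlTensor 0 U (unit₂ false false) := by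
    rw [← extend_eq_controlTensor]; exact Matrix.one_mul _
  have hq' : Circuit.eval U [.queryInv] = controlTensor (0 : Fin 3) Uᴴ (unit₂ true true) +
      controlTensor 0 Uᴴ (unit₂ false false) := by
    rw [← extend_eq_controlTensor]; exact Matrix.one_mul _
  constructor
  · rw [circuit_eval_append, circuit_eval_append, circuit_eval_append, circuit_eval_map_gate, h ι,
      hq, hq', controlled_mul_extend_mul, controlled_mul_extend_mul, controlled_mul_extend_mul,
      Matrix.one_mul, Matrix.mul_one, hU']
    rfl
  · rw [circuit_eval_append, circuit_eval_append, circuit_eval_append, circuit_eval_map_gate, h ι,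
      hq, hq', controlled_mul_extend_mul, controlled_mul_extend_mul, controlled_mul_extend_mul,
      Matrix.mul_one, Matrix.mul_one, hU']
    rfl

/-- A factor `diag (z, 1)` becomes the controlled walk, since the walk acts exactly when the ancilla
is `0`. Thus `(P, Q)` evaluated at the walk operator is the ancilla column reached from `0`. -/
theorem exists_circuit_of_signalProcessable {m n : ℕ} {P Q : ℂ[X]}
    (h : SignalProcessable n P Q) : ∃ c : Circuit m 3,
    Circuit.queries c = 2 * n ∧ Circuit.gates c ≤ n + 1 + n * (2 * (10 * m + 14)) ∧
    ∀ (ι : Type) [Fintype ι] [DecidableEq ι]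
      (U : Matrix (ι × (Fin m → Bool)) (ι × (Fin m → Bool)) ℂ),
      U ∈ unitaryGroup (ι × (Fin m → Bool)) ℂ →
      Circuit.eval U c * controlTensor 0 1 (unit₂ false false) =
        controlTensor 0 (aeval (walk U) P) (unit₂ false false) +
          controlTensor 0 (aeval (walk U) Q) (unit₂ true false) := by
  obtain ⟨cW, _, ⟨hq, hg⟩, -, hcW⟩ := exists_controlled_walk m
  have hsingle : ∀ (V : unitaryGroup Bool ℂ) (ι : Type) [Fintype ι] [DecidableEq ι]
      (U : Matrix (ι × (Fin m → Bool)) (ι × (Fin m → Bool)) ℂ),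
      Circuit.eval U [Step.gate (Gate.single (Sum.inr 0) V)] =
        controlTensor (0 : Fin 3) 1 (V : Matrix Bool Bool ℂ) := by
    intro V ι _ _ U
    rw [controlTensor_one_left]
    exact Matrix.one_mul _
  induction h with
  | base V =>
    refine ⟨[Step.gate (Gate.single (Sum.inr 0) V)], rfl, by simp [Circuit.gates], ?_⟩
    intro ι _ _ U _
    rw [hsingle, controlTensor_mul, Matrix.one_mul, mul_unit₂, controlTensor_add_right,
      controlTensor_smul_right, controlTensor_smul_right, aeval_C, aeval_C,
      Algebra.algebraMap_eq_smul_one, Algebra.algebraMap_eq_smul_one, controlTensor_smul_left,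
      controlTensor_smul_left]
  | @step n P Q V _ ih =>
    obtain ⟨c, hcq, hcg, hc⟩ := ih
    refine ⟨c ++ (cW ++ [Step.gate (Gate.single (Sum.inr 0) V)]), ?_, ?_, ?_⟩
    · simp only [queries_append, hcq, hq, Circuit.queries]; ring
    · simp only [gates_append, Circuit.gates]
      rw [add_mul n]
      omega
    intro ι _ _ U hU
    rw [circuit_eval_append, circuit_eval_append, hsingle, (hcW ι U hU).1, Matrix.mul_assoc,
      hc ι U hU, Matrix.mul_assoc]
    have h1 : (controlTensor 0 1 (unit₂ true true) +
        controlTensor 0 (walk U) (unit₂ false false)) *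
        (controlTensor (0 : Fin 3) (aeval (walk U) P) (unit₂ false false) +
          controlTensor 0 (aeval (walk U) Q) (unit₂ true false)) =
        controlTensor 0 (walk U * aeval (walk U) P) (unit₂ false false) +
          controlTensor 0 (aeval (walk U) Q) (unit₂ true false) := by
      simp only [Matrix.add_mul, Matrix.mul_add, controlTensor_mul]
      simp [unit₂, controlTensor_zero_right, add_comm]
    rw [h1, Matrix.mul_add, controlTensor_mul, controlTensor_mul, Matrix.one_mul, Matrix.one_mul,
      mul_unit₂, mul_unit₂]
    simp only [map_add, map_mul, aeval_C, aeval_X, Algebra.algebraMap_eq_smul_one, smul_mul_assoc,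
      one_mul, controlTensor_add_left, controlTensor_add_right, controlTensor_smul_left,
      controlTensor_smul_right]
    abel

/-- The `2 * d` controlled walks for `P` are followed by `d` controlled inverse walks, so that a
Laurent polynomial is realised; each of the `3 * d` operators costs two queries. -/
theorem exists_circuit_of_polynomial (m d : ℕ) {P : ℂ[X]} (hP : P.natDegree ≤ 2 * d)
    (hlt : ∀ z : ℂ, ‖z‖ = 1 → ‖P.eval z‖ < 1) : ∃ c : Circuit m 3,
    Circuit.queries c = 6 * d ∧ Circuit.gates c ≤ 2 * d + 1 + 6 * d * (10 * m + 14) ∧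
    ∀ (ι : Type) [Fintype ι] [DecidableEq ι]
      (U : Matrix (ι × (Fin m → Bool)) (ι × (Fin m → Bool)) ℂ),
      U ∈ unitaryGroup (ι × (Fin m → Bool)) ℂ → ∀ i j,
      Circuit.eval U c (i, fun _ => false) (j, fun _ => false) =
        (walkInv U ^ d * aeval (walk U) P) (i, fun _ => false) (j, fun _ => false) := by
  obtain ⟨Q, hQ, hPQ⟩ := exists_complementary_polynomial hP hlt
  obtain ⟨c, hcq, hcg, hc⟩ := exists_circuit_of_signalProcessable (m := m)
    (signalProcessable_of_norm_sq_add (2 * d) P Q hP hQ hPQ)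
  obtain ⟨_, cW, -, ⟨hq, hg⟩, hcW⟩ := exists_controlled_walk m
  have hpow : ∀ k : ℕ, ∃ c' : Circuit m 3, Circuit.queries c' = 2 * k ∧
      Circuit.gates c' ≤ k * (2 * (10 * m + 14)) ∧
      ∀ (ι : Type) [Fintype ι] [DecidableEq ι]
        (U : Matrix (ι × (Fin m → Bool)) (ι × (Fin m → Bool)) ℂ),
        U ∈ unitaryGroup (ι × (Fin m → Bool)) ℂ →
        Circuit.eval U c' = controlTensor 0 1 (unit₂ true true) +
          controlTensor 0 (walkInv U ^ k) (unit₂ false false) := by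
    intro k
    induction k with
    | zero =>
      refine ⟨[], rfl, by simp [Circuit.gates], fun ι _ _ U _ => ?_⟩
      rw [pow_zero, ← extend_eq_controlTensor, extend_one]
      rfl
    | succ k ih =>
      obtain ⟨c', hq', hg', h'⟩ := ih
      refine ⟨cW ++ c', ?_, ?_, fun ι _ _ U hU => ?_⟩
      · rw [queries_append, hq, hq']; ring
      · rw [gates_append, add_mul k]; omega
      · rw [circuit_eval_append, h' ι U hU, (hcW ι U hU).2, controlled_mul_extend_mul,
          Matrix.one_mul, pow_succ]
  obtain ⟨c', hq', hg', h'⟩ := hpow d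
  refine ⟨c ++ c', ?_, ?_, fun ι _ _ U hU i j => ?_⟩
  · rw [queries_append, hcq, hq']; ring
  · rw [gates_append]; nlinarith
  rw [← mul_unit_apply_zero 0 (Circuit.eval U (c ++ c')), circuit_eval_append, Matrix.mul_assoc, hc ι U hU, h' ι U hU]
  refine (congrFun (congrFun ?_ _) _).trans (controlTensor_apply_zero (0 : Fin 3) _ i j)
  simp only [Matrix.add_mul, Matrix.mul_add, controlTensor_mul]
  simp [unit₂, controlTensor_zero_right]
  rfl

end Circuits

/-! ### Isometries, and the walk operator on the flag-zero subspace. -/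

section BlockAnalysis

open Function Matrix

variable {n κ : Type} [Fintype n] [DecidableEq n] [Fintype κ] [DecidableEq κ]

/-- The isometry that sends the basis vector `k` to the basis vector `f k`. -/
def inclusionMatrix (f : κ → n) : Matrix n κ ℂ := (1 : Matrix n n ℂ).submatrix id f

omit [Fintype κ] [DecidableEq κ] in
theorem conjTranspose_inclusion_mul_mul (f : κ → n) (M : Matrix n n ℂ) :
    (inclusionMatrix f)ᴴ * M * inclusionMatrix f = M.submatrix f f := by
  have h : (inclusionMatrix f)ᴴ = (1 : Matrix n n ℂ).submatrix f id := by
    rw [inclusionMatrix, conjTranspose_submatrix, conjTranspose_one]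
  ext i j
  rw [h, inclusionMatrix, Matrix.mul_apply]
  simp [Matrix.mul_apply, Matrix.one_apply]

omit [Fintype κ] in
theorem conjTranspose_inclusion_mul_self {f : κ → n} (hf : Injective f) :
    (inclusionMatrix f)ᴴ * inclusionMatrix f = 1 := by
  have := conjTranspose_inclusion_mul_mul f 1
  rw [Matrix.mul_one] at this
  rw [this, submatrix_one f hf]

omit [Fintype n] in
theorem norm_one_le : ‖(1 : Matrix κ κ ℂ)‖ ≤ 1 := by
  have h := CStarRing.norm_star_mul_self (x := (1 : Matrix κ κ ℂ))
  rw [star_one, mul_one] at h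
  nlinarith [norm_nonneg (1 : Matrix κ κ ℂ)]

theorem norm_le_one_of_mem_unitaryGroup {M : Matrix n n ℂ} (hM : M ∈ unitaryGroup n ℂ) :
    ‖M‖ ≤ 1 := by
  have h := CStarRing.norm_star_mul_self (x := M)
  rw [mem_unitaryGroup_iff'.1 hM] at h
  nlinarith [norm_nonneg M, norm_one_le (κ := n)]

theorem norm_submatrix_le {f : κ → n} (hf : Injective f) (M : Matrix n n ℂ) :
    ‖M.submatrix f f‖ ≤ ‖M‖ := by
  have h1 : ‖inclusionMatrix f‖ ≤ 1 := by
    have h := l2_opNorm_conjTranspose_mul_self (inclusionMatrix f)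
    rw [conjTranspose_inclusion_mul_self hf] at h
    nlinarith [norm_nonneg (inclusionMatrix f), norm_one_le (κ := κ)]
  have h2 : ‖(inclusionMatrix f)ᴴ‖ ≤ 1 := by rwa [l2_opNorm_conjTranspose]
  rw [← conjTranspose_inclusion_mul_mul]
  calc ‖(inclusionMatrix f)ᴴ * M * inclusionMatrix f‖
      ≤ ‖(inclusionMatrix f)ᴴ‖ * ‖M‖ * ‖inclusionMatrix f‖ :=
        (l2_opNorm_mul _ _).trans (mul_le_mul_of_nonneg_right (l2_opNorm_mul _ _) (norm_nonneg _))
    _ ≤ 1 * ‖M‖ * 1 := by gcongr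
    _ = ‖M‖ := by ring

/-- The intertwining holds for all powers and hence for the exponential series, term by term. It
replaces a spectral decomposition of the walk. -/
theorem exp_mul_of_mul_eq {T : Matrix n n ℂ} {S : Matrix κ κ ℂ} {X : Matrix n κ ℂ}
    (h : T * X = X * S) : NormedSpace.exp T * X = X * NormedSpace.exp S := by
  have hpow : ∀ k : ℕ, T ^ k * X = X * S ^ k := by
    intro k
    induction k with
    | zero => simp
    | succ k ih => rw [pow_succ, Matrix.mul_assoc, h, ← Matrix.mul_assoc, ih, Matrix.mul_assoc,
        ← pow_succ]
  have h1 := (NormedSpace.exp_series_hasSum_exp' (𝕂 := ℂ) T).map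
    (AddMonoidHom.mk' (fun M : Matrix n n ℂ => M * X) fun A B => Matrix.add_mul A B X)
    (by change Continuous fun M : Matrix n n ℂ => M * X; fun_prop)
  have h2 := (NormedSpace.exp_series_hasSum_exp' (𝕂 := ℂ) S).map
    (AddMonoidHom.mk' (fun M : Matrix κ κ ℂ => X * M) fun A B => Matrix.mul_add X A B)
    (by change Continuous fun M : Matrix κ κ ℂ => X * M; fun_prop)
  refine h1.unique ?_
  convert h2 using 1
  · funext k
    simp [hpow]
  · rfl

variable {ι : Type} [Fintype ι] [DecidableEq ι] {m : ℕ}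

/-- The isometry that adjoins flags in the state `0`. -/
abbrev flagInclusion (ι : Type) [Fintype ι] [DecidableEq ι] (m : ℕ) :
    Matrix (ι × (Fin m → Bool)) ι ℂ :=
  inclusionMatrix fun i => (i, fun _ => false)

theorem flagReflection_eq : flagReflection ι m =
    1 - (2 : ℂ) • (flagInclusion ι m * (flagInclusion ι m)ᴴ) := by
  have h : flagInclusion ι m * (flagInclusion ι m)ᴴ =
      diagonal fun x => if x.2 = fun _ => false then 1 else 0 := by
    ext x y
    rw [Matrix.mul_apply]
    obtain ⟨x, p⟩ := x
    obtain ⟨y, q⟩ := y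
    simp only [flagInclusion, inclusionMatrix, conjTranspose_apply, submatrix_apply, id,
      Matrix.one_apply, diagonal_apply, Prod.mk.injEq]
    by_cases hp : p = fun _ => false
    · subst hp
      by_cases hq : q = fun _ => false
      · subst hq
        simp
      · simp [hq, Ne.symm (a := q) hq]
    · by_cases hxy : x = y ∧ p = q <;> simp [hp]
  rw [h, flagReflection, ← diagonal_one, ← diagonal_smul, diagonal_sub]
  congr 1
  funext x
  by_cases hx : x.2 = fun _ => false
  · simp [hx]; norm_num
  · simp [hx]

theorem flagReflection_mem : flagReflection ι m ∈ unitaryGroup (ι × (Fin m → Bool)) ℂ := by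
  rw [mem_unitaryGroup_iff, star_eq_conjTranspose, flagReflection, diagonal_conjTranspose,
    diagonal_mul_diagonal, ← diagonal_one]
  congr 1
  funext x
  by_cases hx : x.2 = fun _ => false
  · simp [hx]
  · simp [hx]

variable {U : Matrix (ι × (Fin m → Bool)) (ι × (Fin m → Bool)) ℂ}

theorem flagReflection_mul_self : flagReflection ι m * flagReflection ι m = 1 := by
  rw [flagReflection, diagonal_mul_diagonal, ← diagonal_one]
  congr 1
  funext x
  by_cases hx : x.2 = fun _ => false
  · simp [hx]
  · simp [hx]

theorem walk_mem (hU : U ∈ unitaryGroup (ι × (Fin m → Bool)) ℂ) :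
    walk U ∈ unitaryGroup (ι × (Fin m → Bool)) ℂ :=
  mul_mem (mul_mem (mul_mem flagReflection_mem (Unitary.star_mem hU)) flagReflection_mem) hU

theorem walkInv_mem (hU : U ∈ unitaryGroup (ι × (Fin m → Bool)) ℂ) :
    walkInv U ∈ unitaryGroup (ι × (Fin m → Bool)) ℂ :=
  mul_mem (mul_mem (mul_mem (Unitary.star_mem hU) flagReflection_mem) hU) flagReflection_mem

theorem walk_mul_walkInv (hU : U ∈ unitaryGroup (ι × (Fin m → Bool)) ℂ) :
    walk U * walkInv U = 1 := by
  have h1 : U * Uᴴ = 1 := mem_unitaryGroup_iff.1 hU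
  have h2 : Uᴴ * U = 1 := mem_unitaryGroup_iff'.1 hU
  have hR := flagReflection_mul_self (ι := ι) (m := m)
  set R := flagReflection ι m
  calc walk U * walkInv U = R * (Uᴴ * (R * (U * Uᴴ) * R) * U) * R := by
        simp only [walk, walkInv, Matrix.mul_assoc]; rfl
    _ = 1 := by rw [h1, Matrix.mul_one, hR, Matrix.mul_one, h2, Matrix.mul_one, hR]

theorem walkInv_mul_walk (hU : U ∈ unitaryGroup (ι × (Fin m → Bool)) ℂ) :
    walkInv U * walk U = 1 :=
  mul_eq_one_comm.1 (walk_mul_walkInv hU)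

/-- Put `Y = U† R U X`. As `R X = -X`, the left side is `(R - 1) Y = -2 X X† Y`. Here `X† Y = 1 - 2
A²`, because Hermitian `A` is also the block of `U†`. -/
theorem walk_add_walkInv_mul (hU : U ∈ unitaryGroup (ι × (Fin m → Bool)) ℂ) {A : Matrix ι ι ℂ}
    (hA : A.IsHermitian) (hblock : (flagInclusion ι m)ᴴ * U * flagInclusion ι m = A) :
    (walk U + walkInv U) * flagInclusion ι m =
      flagInclusion ι m * ((4 : ℂ) • A ^ 2 - (2 : ℂ) • 1) := by
  have h2 : Uᴴ * U = 1 := mem_unitaryGroup_iff'.1 hU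
  have hX : (flagInclusion ι m)ᴴ * flagInclusion ι m = 1 :=
    conjTranspose_inclusion_mul_self fun i j h => (Prod.mk.inj h).1
  have hblock' : (flagInclusion ι m)ᴴ * Uᴴ * flagInclusion ι m = A := by
    have := congrArg conjTranspose hblock
    rw [conjTranspose_mul, conjTranspose_mul, conjTranspose_conjTranspose, hA.eq] at this
    rw [Matrix.mul_assoc, this]
  have hR := flagReflection_eq (ι := ι) (m := m)
  rw [walk, walkInv]
  set R := flagReflection ι m
  set X := flagInclusion ι m
  have hRX : R * X = -X := by
    rw [hR, Matrix.sub_mul, Matrix.smul_mul, Matrix.mul_assoc, hX, Matrix.one_mul, Matrix.mul_one,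
      two_smul]
    abel
  have hY : Uᴴ * R * U * X = X - (2 : ℂ) • (Uᴴ * X * A) := by
    rw [hR, ← hblock]
    simp only [Matrix.mul_sub, Matrix.sub_mul, Matrix.mul_one, h2, Matrix.one_mul,
      Matrix.mul_smul, Matrix.smul_mul, Matrix.mul_assoc]
  have hXY : Xᴴ * (Uᴴ * R * U * X) = 1 - (2 : ℂ) • A ^ 2 := by
    rw [hY, Matrix.mul_sub, hX, Matrix.mul_smul, ← Matrix.mul_assoc, ← Matrix.mul_assoc, hblock',
      pow_two]
  have hW : R * Uᴴ * R * U * X = R * (Uᴴ * R * U * X) := by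
    simp only [Matrix.mul_assoc]
  have hW' : Uᴴ * R * U * R * X = -(Uᴴ * R * U * X) := by
    rw [Matrix.mul_assoc _ R X, hRX, Matrix.mul_neg]
  rw [Matrix.add_mul, hW, hW']
  generalize Uᴴ * R * U * X = Y at hXY
  rw [hR, Matrix.sub_mul, Matrix.one_mul, Matrix.smul_mul, Matrix.mul_assoc X, hXY]
  rw [sub_add_eq_add_sub, add_neg_cancel, zero_sub, ← Matrix.mul_smul, ← Matrix.mul_neg]
  congr 1
  module

end BlockAnalysis

/-! ### Error bound, choice of the truncation order, and assembly. -/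

section Main

open Function Matrix Polynomial

/-- The spectrum of `exp (t H)` lies in `(0, 1]`. This serves `ε ≥ 1 / 2`, where half the identity
is already a good enough approximation. -/
theorem norm_exp_sub_half_le {N : ℕ} {H : Matrix (Fin N) (Fin N) ℂ} (hH : (-H).PosSemidef)
    {t : ℝ} (ht : 0 < t) :
    ‖NormedSpace.exp (t • H) - ((1 / 2 : ℝ) : ℂ) • (1 : Matrix (Fin N) (Fin N) ℂ)‖ ≤ 1 / 2 := by
  have hpsd : (-(t • H)).PosSemidef := by
    have := hH.smul ht.le
    rwa [smul_neg] at this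
  have hsa : IsSelfAdjoint (t • H) := by
    have : IsSelfAdjoint (-(t • H)) := hpsd.isHermitian
    simpa using this.neg
  have hspec : ∀ x ∈ spectrum ℝ (t • H), x ≤ 0 := by
    intro x hx
    have h1 : -x ∈ spectrum ℝ (-(t • H)) := by
      rw [← spectrum.neg_eq]; simpa using hx
    rw [hpsd.isHermitian.spectrum_real_eq_range_eigenvalues] at h1
    obtain ⟨i, hi⟩ := h1
    have := hpsd.eigenvalues_nonneg i
    linarith
  have h : NormedSpace.exp (t • H) - ((1 / 2 : ℝ) : ℂ) • (1 : Matrix (Fin N) (Fin N) ℂ) =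
      cfc (fun x : ℝ => Real.exp x - 1 / 2) (t • H) := by
    rw [cfc_sub Real.exp (fun _ => 1 / 2) (t • H), cfc_const (1 / 2 : ℝ) (t • H), CFC.real_exp_eq_normedSpace_exp hsa,
      Algebra.algebraMap_eq_smul_one]
    congr 1
  rw [h]
  refine norm_cfc_le (by norm_num) fun x hx => ?_
  have h1 := Real.exp_pos x
  have h2 := Real.exp_le_one_iff.2 (hspec x hx)
  rw [Real.norm_eq_abs, abs_le]
  constructor <;> linarith

/-- Half the truncated expansion of `exp (-(τ / 2) (2 + z + z⁻¹))`, multiplied by `z ^ d`. -/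
noncomputable def gaussPolynomial (τ : ℝ) (d : ℕ) (S : Finset (ℕ × ℕ)) : ℂ[X] :=
  ∑ x ∈ S, C (((-1) ^ (x.1 + x.2) * poissonWeight τ x / 2 : ℝ) : ℂ) * X ^ (d + x.1 - x.2)

theorem natDegree_gaussPolynomial_le {τ : ℝ} {d : ℕ} {S : Finset (ℕ × ℕ)}
    (hS : ∀ x ∈ S, x.1 ≤ d + x.2 ∧ x.2 ≤ d + x.1) :
    (gaussPolynomial τ d S).natDegree ≤ 2 * d :=
  natDegree_sum_le_of_forall_le _ _ fun x hx => (natDegree_C_mul_X_pow_le _ _).trans (by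
    have := (hS x hx).1; omega)

/-- The weights sum to at most 1, and the factor one half makes the bound strict, at the price of
subnormalization 2. -/
theorem norm_eval_gaussPolynomial_lt {τ : ℝ} (hτ : 0 ≤ τ) (d : ℕ) (S : Finset (ℕ × ℕ)) {z : ℂ}
    (hz : ‖z‖ = 1) : ‖(gaussPolynomial τ d S).eval z‖ < 1 := by
  have h1 : ∑ x ∈ S, poissonWeight τ x / 2 ≤ 1 / 2 := by
    rw [← Finset.sum_div]
    have := sum_le_hasSum S (fun x _ => poissonWeight_nonneg hτ x) (hasSum_poissonWeight hτ)
    linarith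
  rw [gaussPolynomial, eval_finsetSum]
  refine lt_of_le_of_lt ((norm_sum_le_of_le _ fun x _ => ?_).trans h1) (by norm_num)
  rw [eval_mul, eval_C, eval_pow, eval_X, norm_mul, norm_pow, hz, one_pow, mul_one,
    Complex.norm_real, norm_div, norm_mul, norm_pow, norm_neg, norm_one, one_pow, one_mul,
    Real.norm_eq_abs, abs_of_nonneg (poissonWeight_nonneg hτ x)]
  norm_num

theorem two_smul_pow_mul_aeval_gaussPolynomial {𝔸 : Type*} [Ring 𝔸] [Algebra ℂ 𝔸] {w w' : 𝔸}
    (h1 : w * w' = 1) (h2 : w' * w = 1) {τ : ℝ} {d : ℕ} {S : Finset (ℕ × ℕ)}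
    (hS : ∀ x ∈ S, x.1 ≤ d + x.2 ∧ x.2 ≤ d + x.1) :
    (2 : ℂ) • (w' ^ d * aeval w (gaussPolynomial τ d S)) =
      ∑ x ∈ S, (((-1) ^ (x.1 + x.2) * poissonWeight τ x : ℝ) : ℂ) • (w ^ x.1 * w' ^ x.2) := by
  have hc : Commute w w' := h1.trans h2.symm
  have hpow1 : ∀ k, w ^ k * w' ^ k = 1 := fun k => by rw [← hc.mul_pow, h1, one_pow]
  have hpow2 : ∀ k, w' ^ k * w ^ k = 1 := fun k => by rw [← hc.symm.mul_pow, h2, one_pow]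
  rw [gaussPolynomial, map_sum, Finset.mul_sum, Finset.smul_sum]
  refine Finset.sum_congr rfl fun x hx => ?_
  -- This makes the natural subtraction in the exponent `d + x.1 - x.2` exact.
  have hx2 := (hS x hx).2
  have hkey : w' ^ d * w ^ (d + x.1 - x.2) = w ^ x.1 * w' ^ x.2 := by
    calc w' ^ d * w ^ (d + x.1 - x.2)
        = w' ^ d * w ^ (d + x.1 - x.2) * (w ^ x.2 * w' ^ x.2) := by rw [hpow1, mul_one]
      _ = w' ^ d * w ^ (d + x.1 - x.2 + x.2) * w' ^ x.2 := by rw [pow_add]; simp only [mul_assoc]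
      _ = w' ^ d * w ^ d * w ^ x.1 * w' ^ x.2 := by
        rw [Nat.sub_add_cancel hx2, pow_add]; simp only [mul_assoc]
      _ = _ := by rw [hpow2, one_mul]
  rw [map_mul, aeval_C, map_pow, aeval_X, Algebra.algebraMap_eq_smul_one, smul_mul_assoc, one_mul,
    mul_smul_comm, hkey, smul_smul]
  congr 1
  push_cast
  ring

/-- The value of `τ` is fixed by `(τ / 2) * 4 / α² = t`. Two intertwinings are composed: from the
walk space to the system, and, by block diagonality of `A²`, from the system to its first `N` basis
states. -/
theorem norm_exp_sub_walk_le {m N K d : ℕ} {α t ε τ : ℝ} (hα : 0 < α) (ht : 0 < t)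
    (hτ : τ = α ^ 2 * t / 2) {S : Finset (ℕ × ℕ)}
    (hS : ∀ x ∈ S, x.1 ≤ d + x.2 ∧ x.2 ≤ d + x.1) (hSε : 1 - ε ≤ ∑ x ∈ S, poissonWeight τ x)
    {A : Matrix (Fin N ⊕ Fin K) (Fin N ⊕ Fin K) ℂ} {H : Matrix (Fin N) (Fin N) ℂ}
    {D : Matrix (Fin K) (Fin K) ℂ}
    {U : Matrix ((Fin N ⊕ Fin K) × (Fin m → Bool)) ((Fin N ⊕ Fin K) × (Fin m → Bool)) ℂ}
    (hA : A.IsHermitian) (hAH : -(A ^ 2) = Matrix.fromBlocks H 0 0 D)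
    (hU : IsBlockEncoding (Function.Embedding.refl (Fin N ⊕ Fin K)) α U A) :
    ‖NormedSpace.exp (t • H) -
      ((2 : ℂ) • (walkInv U ^ d * aeval (walk U) (gaussPolynomial τ d S))).submatrix
        (fun i => (Sum.inl i, fun _ => false)) (fun i => (Sum.inl i, fun _ => false))‖ ≤ ε := by
  obtain ⟨hUU, hUA⟩ := hU
  have hτ0 : 0 ≤ τ := by rw [hτ]; positivity
  have hαC : (α : ℂ) ≠ 0 := Complex.ofReal_ne_zero.2 hα.ne'
  have hblock : (flagInclusion (Fin N ⊕ Fin K) m)ᴴ * U * flagInclusion (Fin N ⊕ Fin K) m =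
      ((α⁻¹ : ℝ) : ℂ) • A := by
    rw [conjTranspose_inclusion_mul_mul, hUA, smul_smul, ← Complex.ofReal_mul,
      inv_mul_cancel₀ hα.ne', Complex.ofReal_one, one_smul]
    rfl
  have hA' : (((α⁻¹ : ℝ) : ℂ) • A).IsHermitian := by
    rw [IsHermitian, conjTranspose_smul, hA.eq]
    simp
  have hZ := walk_add_walkInv_mul hUU hA' hblock
  set w := walk U with hw
  set w' := walkInv U with hw'
  set T := (-(τ / 2 : ℝ) : ℂ) • (2 + w + w') with hT
  have hTX : T * flagInclusion (Fin N ⊕ Fin K) m =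
      flagInclusion (Fin N ⊕ Fin K) m * ((t : ℂ) • -(A ^ 2)) := by
    have h2 : (2 : Matrix ((Fin N ⊕ Fin K) × (Fin m → Bool))
        ((Fin N ⊕ Fin K) × (Fin m → Bool)) ℂ) = (2 : ℂ) • 1 := by
      rw [← Algebra.algebraMap_eq_smul_one, map_ofNat]
    rw [hT, add_assoc, Matrix.smul_mul, Matrix.add_mul, hZ, h2, Matrix.smul_mul, Matrix.one_mul,
      ← Matrix.mul_one ((2 : ℂ) • flagInclusion _ _), Matrix.smul_mul, ← Matrix.mul_smul,
      ← Matrix.mul_add, ← Matrix.mul_smul]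
    congr 1
    rw [add_sub_cancel, _root_.smul_pow, smul_smul, smul_smul, smul_neg, ← neg_smul]
    congr 1
    rw [hτ]
    push_cast
    field_simp
    ring
  have hY : (t : ℂ) • -(A ^ 2) * inclusionMatrix (Sum.inl : Fin N → Fin N ⊕ Fin K) =
      inclusionMatrix (Sum.inl : Fin N → Fin N ⊕ Fin K) * (t • H) := by
    rw [hAH]
    ext i j
    rcases i with i | i <;>
      simp [Matrix.mul_apply, inclusionMatrix, Matrix.one_apply]
  set f : Fin N → (Fin N ⊕ Fin K) × (Fin m → Bool) := fun i => (Sum.inl i, fun _ => false) with hf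
  have hfinj : Injective f := fun i j h => Sum.inl_injective (Prod.mk.inj h).1
  have hXY : flagInclusion (Fin N ⊕ Fin K) m * inclusionMatrix (Sum.inl : Fin N → Fin N ⊕ Fin K) =
      inclusionMatrix f := by
    ext x j
    simp [Matrix.mul_apply, inclusionMatrix, Matrix.one_apply, hf]
  have hTf : T * inclusionMatrix f = inclusionMatrix f * (t • H) := by
    rw [← hXY, ← Matrix.mul_assoc, hTX, Matrix.mul_assoc, hY, Matrix.mul_assoc]
  have hexp : NormedSpace.exp (t • H) = (NormedSpace.exp T).submatrix f f := by
    rw [← conjTranspose_inclusion_mul_mul, Matrix.mul_assoc, exp_mul_of_mul_eq hTf,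
      ← Matrix.mul_assoc, conjTranspose_inclusion_mul_self hfinj, Matrix.one_mul]
  have hsub : ∀ M M' : Matrix ((Fin N ⊕ Fin K) × (Fin m → Bool)) ((Fin N ⊕ Fin K) × (Fin m → Bool)) ℂ,
      M.submatrix f f - M'.submatrix f f = (M - M').submatrix f f := fun _ _ => rfl
  have h1 := walk_mul_walkInv hUU
  have h2 := walkInv_mul_walk hUU
  rw [hexp, two_smul_pow_mul_aeval_gaussPolynomial h1 h2 hS, hsub]
  refine (norm_submatrix_le hfinj _).trans ?_
  have := norm_exp_sub_sum_le hτ0 (show Commute w w' from h1.trans h2.symm)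
    (fun k => norm_le_one_of_mem_unitaryGroup (pow_mem (walk_mem hUU) k))
    (fun k => norm_le_one_of_mem_unitaryGroup (pow_mem (walkInv_mem hUU) k)) S
  linarith

/-- For `ε < 1 / 2` one has `log (4 / ε) ≤ 3 log (1 / ε)`, and `log (1 / ε) ≥ log 2` absorbs the
rounding up to an integer. -/
theorem exists_truncation_order {α t ε : ℝ} (hα : 0 < α) (ht : 0 < t) (hε : 0 < ε)
    (hε2 : ε < 1 / 2) : ∃ d : ℕ,
      2 * √(α ^ 2 * t / 2 * Real.log (4 / ε)) + 2 * Real.log (4 / ε) ≤ d ∧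
      (d : ℝ) ≤ 8 * (α * √(t * Real.log (1 / ε)) + Real.log (1 / ε)) := by
  have hlog2 : Real.log 2 ≤ Real.log (1 / ε) :=
    Real.log_le_log (by norm_num) (by rw [le_div_iff₀ hε]; linarith)
  have hl2 := Real.log_two_gt_d9
  have hL : Real.log (4 / ε) = 2 * Real.log 2 + Real.log (1 / ε) := by
    rw [show 4 / ε = 2 * 2 * (1 / ε) by ring, Real.log_mul (by norm_num) (by positivity),
      Real.log_mul (by norm_num) (by norm_num)]
    ring
  set l := Real.log (1 / ε)
  have hl0 : 0 < l := by linarith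
  have hsqrt : √(α ^ 2 * t / 2 * Real.log (4 / ε)) ≤ 2 * (α * √(t * l)) := by
    rw [hL]
    apply Real.sqrt_le_iff.2
    refine ⟨by positivity, ?_⟩
    rw [mul_pow, mul_pow, Real.sq_sqrt (by positivity)]
    have : 0 < α ^ 2 * t := by positivity
    nlinarith
  refine ⟨_, Nat.le_ceil _, ?_⟩
  have h0 : 0 ≤ 2 * √(α ^ 2 * t / 2 * Real.log (4 / ε)) + 2 * Real.log (4 / ε) := by
    rw [hL]; positivity
  have := (Nat.ceil_lt_add_one h0).le
  have hR : 0 ≤ α * √(t * l) := by positivity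
  rw [hL] at *
  linarith

end Main

end GaussLCHS

theorem mainTheorem2 :
    ∃ C : ℝ, 0 < C ∧
      ∀ (m : ℕ) (α t ε : ℝ), 0 < α → 0 < t → 0 < ε → ε < min (1 / α) 1 →
        ∃ (a : ℕ) (c : GaussLCHS.Circuit m a) (αg : ℝ),
          0 < αg ∧ αg ≤ C ∧
          (GaussLCHS.Circuit.queries c : ℝ) ≤
            C * (α * √(t * Real.log (1 / ε)) + Real.log (max α 1 / ε)) ∧
          (a : ℝ) ≤ C * Real.log (2 + α * √(t * Real.log (1 / ε))) ∧
          (GaussLCHS.Circuit.gates c : ℝ) ≤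
            C * (m + 1) * (α * √(t * Real.log (1 / ε)) + Real.log (max α 1 / ε)) ∧
          ∀ (N K : ℕ) (A : Matrix (Fin N ⊕ Fin K) (Fin N ⊕ Fin K) ℂ)
            (H : Matrix (Fin N) (Fin N) ℂ) (D : Matrix (Fin K) (Fin K) ℂ)
            (U : Matrix ((Fin N ⊕ Fin K) × (Fin m → Bool))
              ((Fin N ⊕ Fin K) × (Fin m → Bool)) ℂ),
            A.IsHermitian → (-H).PosSemidef →
            -(A ^ 2) = Matrix.fromBlocks H 0 0 D →
            GaussLCHS.IsBlockEncoding (Function.Embedding.refl (Fin N ⊕ Fin K)) α U A →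
            ∃ E : Matrix (Fin N) (Fin N) ℂ,
              GaussLCHS.IsBlockEncoding Function.Embedding.inl αg
                (GaussLCHS.Circuit.eval U c) E ∧
              ‖NormedSpace.exp (t • H) - E‖ ≤ ε := by
  -- The gate count is the demanding bound: `d ≤ 8 Q` and `1 ≤ 2 Q` give at most `(690 + 480 m) Q`.
  refine ⟨1000, by norm_num, fun m α t ε hα ht hε hεmin => ?_⟩
  have hε1 : ε < 1 := hεmin.trans_le (min_le_right _ _)
  have hl : Real.log (1 / ε) ≤ Real.log (max α 1 / ε) :=
    Real.log_le_log (by positivity) (by gcongr; exact le_max_right _ _)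
  have hl0 : 0 < Real.log (1 / ε) := Real.log_pos (by rw [lt_div_iff₀ hε]; linarith)
  have hR : 0 ≤ α * √(t * Real.log (1 / ε)) := by positivity
  have hl2 := Real.log_two_gt_d9
  have hlR : Real.log 2 ≤ Real.log (2 + α * √(t * Real.log (1 / ε))) :=
    Real.log_le_log (by norm_num) (by linarith)
  -- As `ε` tends to 1 with `α ≤ 1`, the allowed cost can tend to 0, so the circuit must be empty
  -- there. It encodes half the identity, with factor `1 / 2`.
  by_cases hε2 : 1 / 2 ≤ ε
  · refine ⟨0, [], 1 / 2, by norm_num, by norm_num, ?_, ?_, ?_, ?_⟩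
    · simp only [GaussLCHS.Circuit.queries, Nat.cast_zero]
      nlinarith
    · rw [Nat.cast_zero]; linarith
    · simp only [GaussLCHS.Circuit.gates, Nat.cast_zero]
      have : 0 ≤ α * √(t * Real.log (1 / ε)) + Real.log (max α 1 / ε) := by linarith
      positivity
    · intro N K A H D U _ hH _ _
      refine ⟨_, ⟨one_mem _, rfl⟩, ?_⟩
      rw [GaussLCHS.Circuit.eval, Matrix.submatrix_one]
      · exact (GaussLCHS.norm_exp_sub_half_le hH ht).trans hε2
      · exact fun i j h => Sum.inl_injective (Prod.mk.inj h).1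
  · push Not at hε2
    obtain ⟨d, hd, hd'⟩ := GaussLCHS.exists_truncation_order hα ht hε hε2
    obtain ⟨S, hS, hSε⟩ := GaussLCHS.exists_finset_poissonWeight (by positivity) hε hε1 hd
    obtain ⟨c, hcq, hcg, hc⟩ := GaussLCHS.exists_circuit_of_polynomial m d
      (GaussLCHS.natDegree_gaussPolynomial_le (τ := α ^ 2 * t / 2) hS)
      (fun z hz => GaussLCHS.norm_eval_gaussPolynomial_lt (by positivity) d S hz)
    have hlog2 : Real.log 2 ≤ Real.log (1 / ε) :=
      Real.log_le_log (by norm_num) (by rw [le_div_iff₀ hε]; linarith)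
    refine ⟨3, c, 2, by norm_num, by norm_num, ?_, ?_, ?_, ?_⟩
    · rw [hcq]
      push_cast
      linarith
    · push_cast; linarith
    · have hcg' : (GaussLCHS.Circuit.gates c : ℝ) ≤ 2 * d + 1 + 6 * d * (10 * m + 14) := by
        exact_mod_cast hcg
      refine hcg'.trans ?_
      set Q := α * √(t * Real.log (1 / ε)) + Real.log (max α 1 / ε) with hQ
      have hdQ : (d : ℝ) ≤ 8 * Q := by linarith
      have hQ1 : 1 ≤ 2 * Q := by linarith
      have hm : (0 : ℝ) ≤ m := m.cast_nonneg
      have h1 : (d : ℝ) * (m + 1) ≤ 8 * Q * (m + 1) := by gcongr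
      have h2 : 0 ≤ (d : ℝ) * m := by positivity
      have h3 : 0 ≤ Q * m := by nlinarith
      linarith
    · intro N K A H D U hA _ hAH hU
      refine ⟨_, ⟨GaussLCHS.circuit_eval_mem U hU.1 c, rfl⟩, ?_⟩
      convert GaussLCHS.norm_exp_sub_walk_le hα ht rfl hS hSε hA hAH hU using 3
      ext i j
      exact congrArg (fun z : ℂ => ((2 : ℝ) : ℂ) * z) (hc _ U hU.1 (Sum.inl i) (Sum.inl j))
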